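/- Setting. There are $K$ tasks and a budget of $U\in\mathbb N$ workers, a time horizon $T\in\mathbb R$, an arrival rate $r>0$, a completion rate $\mu>0$, thresholds $d_x\in\mathbb R$ and prior parameters $\alpha_{0,x},\beta_{0,x}>0$ ($x=1,\dots,K$). A state is $s=(\alpha,\beta,t,w,\ell)\in\mathbb S=\mathbb R^K\times\mathbb R^K\times\mathbb R\times\mathbb N^K\times\mathbb N$. Here $\alpha,\beta$ are the parameters of the Beta posteriors, $t$ is the time of the last event, $w_x$ is the number of workers working on task $x$, and $\ell$ is the number of workers who have entered so far. Let $\Pi$ be the set of measurable maps $\pi:\mathbb S\times\mathbb R_+\to\{0,1\}^K$, and let $\Pi_0$ be the set of those with $\sum_x\pi(s,\Delta)_x\le 1$ for all $(s,\Delta)$. Each $\pi\in\Pi$ defines a Markov chain $(S_n)_{n\ge0}$ with $S_0=(\alpha_0,\beta_0,0,0,0)$ and the following transitions from $s=(\alpha,\beta,t,w,\ell)$. Put $q=\mu\sum_x w_x+r$ and draw $\Delta\sim\mathrm{Exp}(q)$. - If $t+\Delta\ge T$, the next state is $(\alpha,\beta,t+\Delta,0,\ell)$. - If $t+\Delta<T$,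 then with probability $r/q$ a worker arrives. The next state is $(\alpha,\beta,t+\Delta,w+\pi(s,\Delta),\ell+1)$ if $\ell<U$, and $(\alpha,\beta,t+\Delta,w,\ell)$ if $\ell\ge U$. - If $t+\Delta<T$, then for each $x$, with probability $\frac{\alpha_x}{\alpha_x+\beta_x}\frac{\mu w_x}{q}$, the next state is $(\alpha+e_x,\beta,t+\Delta,w-e_x,\ell)$. - If $t+\Delta<T$, then for each $x$, with probability $\frac{\beta_x}{\alpha_x+\beta_x}\frac{\mu w_x}{q}$, the next state is $(\alpha,\beta+e_x,t+\Delta,w-e_x,\ell)$. Let $N$ be the first $n$ such that $S_n$ satisfies $t\ge T$, or $\ell\ge U$ and $w=0$. Let $$R_x=\max\{\mathbb P[\theta>d_x],\mathbb P[\theta<d_x]\},\qquad \theta\sim\mathrm{Beta}(\alpha_x(S_N),\beta_x(S_N)),$$ $R=\sum_xR_x$ and $R_0=\sup_{\pi\in\Pi_0}\mathbb E^\pi[R]$. For $1\le\ell\le U$ let $n_\ell$ be the first $n$ with $\ell(S_n)=\ell$, and let $a_{\ell,x}=\pi(S_{n_\ell-1},\Delta_{n_\ell-1})_x$, where $\Delta_n=t(S_{n+1})-t(S_n)$;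 put $a_{\ell,x}=0$ if fewer than $\ell$ workers enter. The single-task problem for $x$ is the same controlled chain with $x$ as its only task. Its state space is $\mathbb R\times\mathbb R\times\mathbb R\times\mathbb N\times\mathbb N$, which does not depend on $K$. Its policies $\pi^{(x)}\in\Pi^{(x)}$ are the measurable maps from $(\mathbb R\times\mathbb R\times\mathbb R\times\mathbb N\times\mathbb N)\times\mathbb R_+$ to $\{0,1\}$, and its $R_x$ and $a_{\ell,x}$ are defined as above. Theorem. The following hold. 1. The chains reach $N<\infty$ almost surely, the rewards (penalized or not) are integrable, and the suprema and the infimum below are finite. 2. For every $\lambda\in\mathbb R^U$ with $\lambda\ge0$, $$R_0\le\sum_{x=1}^K\ \sup_{\pi^{(x)}\in\Pi^{(x)}}\mathbb E^{\pi^{(x)}}\Big[R_x-\sum_{\ell=1}^U\lambda_\ell a_{\ell,x}\Big]+\sum_{\ell=1}^U\lambda_\ell .$$ 3. Consequently $$R_0\le\inf_{\lambda\ge0}\Big(\sum_{x=1}^K\ \sup_{\pi^{(x)}\in\Pi^{(x)}}\mathbb E^{\pi^{(x)}}\Big[R_x-\sum_{\ell=1}^U\lambda_\ell a_{\ell,x}\Big]+\sum_{\ell=1}^U\lambda_\ell\Big).$$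 -/

import Mathlib

open MeasureTheory ProbabilityTheory
open scoped NNReal ENNReal

namespace Crowdsourcing

/-- A state `s = (α, β, t, w, ℓ)` of the system with task set `ι`: the parameters of the Beta
posteriors, the time of the most recent event, the number of workers currently working on each
task, and the number of workers that have entered the system so far. -/
abbrev State (ι : Type*) : Type _ := (ι → ℝ) × (ι → ℝ) × ℝ × (ι → ℕ) × ℕ

namespace State

variable {ι : Type*}

/-- First parameters of the Beta posteriors. -/
def alpha (s : State ι) : ι → ℝ := s.1
/-- Second parameters of the Beta posteriors. -/
def beta (s : State ι) : ι → ℝ := s.2.1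
/-- Time of the most recent event. -/
def time (s : State ι) : ℝ := s.2.2.1
/-- Number of workers currently working on each task. -/
def work (s : State ι) : ι → ℕ := s.2.2.2.1
/-- Number of workers that have entered the system. -/
def count (s : State ι) : ℕ := s.2.2.2.2

@[fun_prop] lemma measurable_alpha : Measurable (alpha : State ι → ι → ℝ) := by
  unfold alpha; fun_prop
@[fun_prop] lemma measurable_beta : Measurable (beta : State ι → ι → ℝ) := by
  unfold beta; fun_prop
@[fun_prop] lemma measurable_time : Measurable (time : State ι → ℝ) := by
  unfold time; fun_prop
@[fun_prop] lemma measurable_work : Measurable (work : State ι → ι → ℕ) := by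
  unfold work; fun_prop
@[fun_prop] lemma measurable_count : Measurable (count : State ι → ℕ) := by
  unfold count; fun_prop

end State

/-- `𝕊 × ℝ₊ → {0,1}^ι`, measurable: how many new workers (0 or 1) each task gets, when a worker
arrives after time `Δ` in state `s`. -/
abbrev Policy (ι : Type*) : Type _ :=
  {π : State ι × ℝ≥0 → ι → Fin 2 // Measurable π}

/-- The policies that assign at most one task to an incoming worker. -/
def feasiblePolicies (ι : Type*) [Fintype ι] : Set (Policy ι) :=
  {π | ∀ (s : State ι) (Δ : ℝ≥0), ∑ x, (π.1 (s, Δ) x : ℕ) ≤ 1}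

/-- Posterior probability `a / (a + b)` that a label is positive. Parameters of Beta
distributions are positive, so the value `0` in the other case concerns unreachable states only. -/
noncomputable def posProb (a b : ℝ) : ℝ := if 0 < a ∧ 0 < b then a / (a + b) else 0

lemma posProb_nonneg (a b : ℝ) : 0 ≤ posProb a b := by
  unfold posProb; split_ifs with h
  · have := h.1; have := h.2; positivity
  · exact le_rfl

lemma posProb_le_one (a b : ℝ) : posProb a b ≤ 1 := by
  unfold posProb; split_ifs with h
  · rw [div_le_one (by linarith [h.1, h.2])]; linarith [h.2]
  · exact zero_le_one

@[fun_prop] lemma measurable_posProb : Measurable (fun p : ℝ × ℝ => posProb p.1 p.2) := by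
  unfold posProb
  refine Measurable.ite ?_ (by fun_prop) measurable_const
  exact (measurableSet_lt measurable_const measurable_fst).inter
    (measurableSet_lt measurable_const measurable_snd)

/-- `R(a, b) = max {P[θ > d], P[θ < d]}` for `θ ∼ Beta(a, b)`. -/
noncomputable def labelReward (d a b : ℝ) : ℝ :=
  max ((betaMeasure a b).real (Set.Ioi d)) ((betaMeasure a b).real (Set.Iio d))

/-- Parameters of the effort allocation problem with task set `ι`. -/
structure Model (ι : Type*) where
  /-- arrival rate of workers -/
  r : ℝ
  /-- completion rate of a worker -/
  μ : ℝ
  /-- time horizon -/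
  T : ℝ
  /-- worker budget -/
  U : ℕ
  /-- thresholds -/
  d : ι → ℝ
  /-- first parameters of the Beta priors -/
  α₀ : ι → ℝ
  /-- second parameters of the Beta priors -/
  β₀ : ι → ℝ
  r_pos : 0 < r
  μ_pos : 0 < μ
  α₀_pos : ∀ x, 0 < α₀ x
  β₀_pos : ∀ x, 0 < β₀ x

namespace Model

variable {ι : Type*}

/-- The same problem for the task `x` alone. Its state space `State Unit` is
`ℝ × ℝ × ℝ × ℕ × ℕ`, written with functions on a one-point type, and its policies take values
in `{0,1}`. -/
abbrev single (M : Model ι) (x : ι) : Model Unit where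
  r := M.r
  μ := M.μ
  T := M.T
  U := M.U
  d := fun _ => M.d x
  α₀ := fun _ => M.α₀ x
  β₀ := fun _ => M.β₀ x
  r_pos := M.r_pos
  μ_pos := M.μ_pos
  α₀_pos := fun _ => M.α₀_pos x
  β₀_pos := fun _ => M.β₀_pos x

/-- The initial state. -/
def initial (M : Model ι) : State ι := (M.α₀, M.β₀, 0, 0, 0)

section Dynamics

variable [Fintype ι]

/-- Total event rate `q(s)`. -/
def rate (M : Model ι) (s : State ι) : ℝ := M.μ * ∑ x, (s.work x : ℝ) + M.r

lemma rate_pos (M : Model ι) (s : State ι) : 0 < M.rate s := by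
  have h1 := M.r_pos
  have h2 := M.μ_pos
  unfold rate
  positivity

/-- Law `Exp(q(s))` of the time until the next event. -/
noncomputable def delayKernel (M : Model ι) : Kernel (State ι) ℝ where
  toFun s := expMeasure (M.rate s)
  measurable' := by
    have h : Measurable fun w : ι → ℕ => expMeasure (M.μ * ∑ x, (w x : ℝ) + M.r) :=
      Measurable.of_discrete
    exact h.comp State.measurable_work

instance (M : Model ι) : IsMarkovKernel M.delayKernel :=
  ⟨fun s => isProbabilityMeasure_expMeasure (M.rate_pos s)⟩

/-- The time horizon elapses: all outstanding work is cancelled. -/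
def cancelled (p : State ι × ℝ) : State ι :=
  (p.1.alpha, p.1.beta, p.1.time + p.2, 0, p.1.count)

/-- A worker arrives; he is allocated by the policy if the budget is not exhausted. -/
noncomputable def arrival (M : Model ι) (π : Policy ι) (p : State ι × ℝ) : State ι :=
  if p.1.count < M.U then
    (p.1.alpha, p.1.beta, p.1.time + p.2,
      fun x => p.1.work x + (π.1 (p.1, p.2.toNNReal) x : ℕ), p.1.count + 1)
  else (p.1.alpha, p.1.beta, p.1.time + p.2, p.1.work, p.1.count)

@[fun_prop] lemma measurable_rate (M : Model ι) : Measurable M.rate := by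
  unfold rate; fun_prop

lemma measurable_arrival (M : Model ι) (π : Policy ι) : Measurable (M.arrival π) := by
  have hπ : Measurable fun p : State ι × ℝ => π.1 (p.1, p.2.toNNReal) :=
    π.2.comp (by fun_prop)
  have hw : Measurable fun p : State ι × ℝ =>
      fun x => p.1.work x + (π.1 (p.1, p.2.toNNReal) x : ℕ) := by
    refine measurable_pi_lambda _ fun x => Measurable.add (by fun_prop) ?_
    exact (Measurable.of_discrete (f := fun i : Fin 2 => (i : ℕ))).comp
      ((measurable_pi_apply x).comp hπ)
  unfold arrival
  exact Measurable.ite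
    (measurableSet_lt (State.measurable_count.comp measurable_fst) measurable_const)
    ((State.measurable_alpha.comp measurable_fst).prodMk
      ((State.measurable_beta.comp measurable_fst).prodMk
        (((State.measurable_time.comp measurable_fst).add measurable_snd).prodMk
          (hw.prodMk ((State.measurable_count.comp measurable_fst).add_const 1)))))
    (by fun_prop)

end Dynamics

section Chain

variable [Fintype ι] [DecidableEq ι]

/-- A worker completes task `x` with a positive label. -/
def positive (x : ι) (p : State ι × ℝ) : State ι :=
  (p.1.alpha + Pi.single x 1, p.1.beta, p.1.time + p.2, p.1.work - Pi.single x 1, p.1.count)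

/-- A worker completes task `x` with a negative label. -/
def negative (x : ι) (p : State ι × ℝ) : State ι :=
  (p.1.alpha, p.1.beta + Pi.single x 1, p.1.time + p.2, p.1.work - Pi.single x 1, p.1.count)

/-- Law of the next state given the state `p.1` and the time `p.2` until the next event. -/
noncomputable def jumpLaw (M : Model ι) (π : Policy ι) (p : State ι × ℝ) : Measure (State ι) :=
  if M.T ≤ p.1.time + p.2 then Measure.dirac (cancelled p)
  else
    ENNReal.ofReal (M.r / M.rate p.1) • Measure.dirac (M.arrival π p) +
    ∑ x, (ENNReal.ofReal (posProb (p.1.alpha x) (p.1.beta x) * (M.μ * p.1.work x / M.rate p.1)) •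
            Measure.dirac (positive x p) +
          ENNReal.ofReal
            ((1 - posProb (p.1.alpha x) (p.1.beta x)) * (M.μ * p.1.work x / M.rate p.1)) •
            Measure.dirac (negative x p))


lemma measurable_smul_dirac {α β : Type*} [MeasurableSpace α] [MeasurableSpace β]
    {c : α → ℝ} {f : α → β} (hc : Measurable c) (hf : Measurable f) :
    Measurable fun a => ENNReal.ofReal (c a) • Measure.dirac (f a) := by
  refine Measure.measurable_of_measurable_coe _ fun s hs => ?_
  simp only [Measure.smul_apply, smul_eq_mul, Measure.dirac_apply' _ hs]
  exact hc.ennreal_ofReal.mul ((measurable_one.indicator hs).comp hf)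

lemma measurable_add_measure {α β : Type*} [MeasurableSpace α] [MeasurableSpace β]
    {f g : α → Measure β} (hf : Measurable f) (hg : Measurable g) :
    Measurable fun a => f a + g a := by
  refine Measure.measurable_of_measurable_coe _ fun s hs => ?_
  simp only [Measure.add_apply]
  exact ((Measure.measurable_coe hs).comp hf).add ((Measure.measurable_coe hs).comp hg)

lemma measurable_sum_measure {α β γ : Type*} [MeasurableSpace α] [MeasurableSpace β]
    (t : Finset γ) {f : γ → α → Measure β} (hf : ∀ i, Measurable (f i)) :
    Measurable fun a => ∑ i ∈ t, f i a := by
  refine Measure.measurable_of_measurable_coe _ fun s hs => ?_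
  simp only [Measure.finsetSum_apply]
  exact Finset.measurable_sum _ fun i _ => (Measure.measurable_coe hs).comp (hf i)

lemma measurable_jumpLaw (M : Model ι) (π : Policy ι) : Measurable (M.jumpLaw π) := by
  have hp : ∀ x, Measurable fun p : State ι × ℝ => posProb (p.1.alpha x) (p.1.beta x) :=
    fun x => measurable_posProb.comp (f := fun p : State ι × ℝ => (p.1.alpha x, p.1.beta x))
      (by fun_prop)
  have hw : ∀ x, Measurable fun p : State ι × ℝ => M.μ * (p.1.work x : ℝ) / M.rate p.1 :=
    fun x => by fun_prop
  unfold jumpLaw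
  refine Measurable.ite (measurableSet_le measurable_const (by fun_prop)) ?_ ?_
  · exact Measure.measurable_dirac.comp (by unfold cancelled; fun_prop)
  · refine measurable_add_measure
      (measurable_smul_dirac (by fun_prop) (M.measurable_arrival π))
      (measurable_sum_measure _ fun x => measurable_add_measure
        (measurable_smul_dirac ((hp x).mul (hw x)) ?_)
        (measurable_smul_dirac (((hp x).const_sub 1).mul (hw x)) ?_))
    · unfold positive; fun_prop
    · unfold negative; fun_prop

/-- The law of `S (n + 1)` given `S n` and `Δ n`, as a kernel. -/
noncomputable def jumpKernel (M : Model ι) (π : Policy ι) : Kernel (State ι × ℝ) (State ι) where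
  toFun := M.jumpLaw π
  measurable' := M.measurable_jumpLaw π

instance (M : Model ι) (π : Policy ι) : IsMarkovKernel (M.jumpKernel π) := by
  refine ⟨fun p => ⟨?_⟩⟩
  change M.jumpLaw π p Set.univ = 1
  have hq := M.rate_pos p.1
  have hμ := M.μ_pos
  have hr := M.r_pos
  unfold jumpLaw
  split_ifs
  · simp
  · have key : ∀ x, ENNReal.ofReal
          (posProb (p.1.alpha x) (p.1.beta x) * (M.μ * p.1.work x / M.rate p.1)) +
        ENNReal.ofReal
          ((1 - posProb (p.1.alpha x) (p.1.beta x)) * (M.μ * p.1.work x / M.rate p.1)) =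
        ENNReal.ofReal (M.μ * p.1.work x / M.rate p.1) := by
      intro x
      have h1 := posProb_nonneg (p.1.alpha x) (p.1.beta x)
      have h2 := sub_nonneg.2 (posProb_le_one (p.1.alpha x) (p.1.beta x))
      rw [← ENNReal.ofReal_add (by positivity) (by positivity)]
      congr 1
      ring
    simp only [Measure.add_apply, Measure.finsetSum_apply, Measure.smul_apply, smul_eq_mul,
      measure_univ, mul_one, key]
    rw [← ENNReal.ofReal_sum_of_nonneg (fun x _ => by positivity),
      ← ENNReal.ofReal_add (by positivity) (Finset.sum_nonneg fun x _ => by positivity),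
      ← Finset.sum_div, ← Finset.mul_sum, ← add_div, add_comm M.r]
    change ENNReal.ofReal (M.rate p.1 / M.rate p.1) = 1
    rw [div_self hq.ne', ENNReal.ofReal_one]

/-- Transition kernel of the chain: draw `Δ ∼ Exp(q(s))`, then the next state given `(s, Δ)`. -/
noncomputable def transition (M : Model ι) (π : Policy ι) : Kernel (State ι) (State ι) :=
  M.jumpKernel π ∘ₖ (Kernel.id ×ₖ M.delayKernel)

instance (M : Model ι) (π : Policy ι) : IsMarkovKernel (M.transition π) := by
  unfold transition; infer_instance

/-- The law on `ℕ → State ι` of the Markov chain `(S n)` started at the initial state. -/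
noncomputable def law (M : Model ι) (π : Policy ι) : Measure (ℕ → State ι) :=
  Kernel.trajMeasure (X := fun _ => State ι) (Measure.dirac M.initial)
    (fun n => (M.transition π).comap
      (fun h : (i : Finset.Iic n) → State ι => h ⟨n, Finset.mem_Iic.2 le_rfl⟩)
      (measurable_pi_apply _))

end Chain

/-- The states in which the horizon has elapsed, or the budget is exhausted and all allocated
workers have finished. -/
def terminal (M : Model ι) : Set (State ι) :=
  {s | M.T ≤ s.time ∨ (M.U ≤ s.count ∧ s.work = 0)}

/-- The first time `N` at which the chain is in a terminal state. -/
noncomputable def endTime (M : Model ι) (S : ℕ → State ι) : ℕ := sInf {n | S n ∈ M.terminal}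

/-- The reward `R_x` from task `x`. -/
noncomputable def taskReward (M : Model ι) (x : ι) (S : ℕ → State ι) : ℝ :=
  labelReward (M.d x) ((S (M.endTime S)).alpha x) ((S (M.endTime S)).beta x)

/-- The time `Δ n` between the events `n` and `n + 1`. -/
noncomputable def delay (S : ℕ → State ι) (n : ℕ) : ℝ≥0 := ((S (n + 1)).time - (S n).time).toNNReal

/-- The number `n_ℓ` of events up to and including the arrival of worker `ℓ`. -/
noncomputable def arrivalIndex (S : ℕ → State ι) (ℓ : ℕ) : ℕ := sInf {n | (S n).count = ℓ}

open Classical in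
/-- `a_{ℓ,x} = 1` if worker `ℓ` (`ℓ ≥ 1`) is assigned to task `x`, and `0` otherwise, in particular
if fewer than `ℓ` workers enter the system. -/
noncomputable def assigned (π : Policy ι) (S : ℕ → State ι) (ℓ : ℕ) (x : ι) : ℝ :=
  if ∃ n, (S n).count = ℓ then
    ((π.1 (S (arrivalIndex S ℓ - 1), delay S (arrivalIndex S ℓ - 1)) x : ℕ) : ℝ)
  else 0

variable [Fintype ι]

/-- The total reward `R`. -/
noncomputable def reward (M : Model ι) (S : ℕ → State ι) : ℝ := ∑ x, M.taskReward x S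

/-- `R₀`, the optimal value over the policies that assign at most one task to each worker. -/
noncomputable def optimalValue [DecidableEq ι] (M : Model ι) : ℝ :=
  ⨆ π : feasiblePolicies ι, ∫ S, M.reward S ∂(M.law π.1)

/-- In a problem with one task: the reward minus the prices `lam` of the workers assigned to the
task. Worker `ℓ + 1` has the price `lam ℓ`. -/
noncomputable def penalizedReward (M : Model Unit) (lam : Fin M.U → ℝ) (π : Policy Unit)
    (S : ℕ → State Unit) : ℝ :=
  M.taskReward () S - ∑ ℓ : Fin M.U, lam ℓ * assigned π S (ℓ + 1) ()

/-- The optimal value of the penalized problem with one task, over all policies. -/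
noncomputable def penalizedValue (M : Model Unit) (lam : Fin M.U → ℝ) : ℝ :=
  ⨆ π : Policy Unit, ∫ S, M.penalizedReward lam π S ∂(M.law π)

/-- `∑ₓ sup E[R_x - ∑ λ_ℓ a_{ℓ,x}] + ∑ λ_ℓ`. -/
noncomputable def bound (M : Model ι) (lam : Fin M.U → ℝ) : ℝ :=
  ∑ x, (M.single x).penalizedValue lam + ∑ ℓ, lam ℓ

end Model

end Crowdsourcing

namespace Crowdsourcing

/-! ### The exponential distribution and linear backward equations -/

/-! The bound is weak Lagrangian duality followed by a decomposition over tasks. Under a feasible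
policy each worker gets at most one task, so for `lam ≥ 0` adding `∑ lam ℓ * (1 - ∑ₓ a_{ℓ,x})` to
the reward does not lower it, and what results splits into one penalized reward per task
(`integral_reward_le_bound`).

It remains to bound the penalized reward of task `x` under a policy of the full system by the
single-task optimum. Such a policy may look at the other tasks, so it is not itself a single-task
policy; a verification argument replaces a comparison of policies. `taskValue` solves the Bellman
equation of task `x`, a linear backward equation in time for each value of the discrete parameters.
Completions at other tasks and arrivals beyond the budget leave these parameters unchanged, and by
uniformization (`integral_expMeasure_eq`) the equation is an expectation identity for an exponential
clock of any rate, in particular the total rate of the full system. Hence the value minus the prices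
paid has nonincreasing expectation under every policy and constant expectation under the greedy one
(`integral_transition_stateValue`, `integral_netValue_succ`).

The horizon passes almost surely, and from then on this process equals the penalized reward.
Dominated convergence gives `integral_penalized_le` and `integral_penalized_greedy`. Applied to the
full system and to the single-task system respectively, they share the same initial value
(`stateValue_single`), which closes the argument. -/

lemma integral_expMeasure {q : ℝ} (hq : 0 < q) (h : ℝ → ℝ) :
    ∫ Δ, h Δ ∂expMeasure q = ∫ Δ in Set.Ioi 0, q * Real.exp (-(q * Δ)) * h Δ := by
  have h1 : expMeasure q = volume.withDensity (exponentialPDF q) := rfl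
  have hm : Measurable (exponentialPDF q) := (measurable_exponentialPDFReal q).ennreal_ofReal
  rw [h1, integral_withDensity_eq_integral_toReal_smul hm
    (Filter.Eventually.of_forall fun x => ENNReal.ofReal_lt_top),
    ← integral_indicator measurableSet_Ioi]
  refine integral_congr_ae ?_
  -- The density is positive at `0`, which `Set.Ioi 0` omits; the integrands agree off this null
  -- point.
  filter_upwards [compl_mem_ae_iff.2 (measure_singleton (0 : ℝ))] with x hx
  rw [smul_eq_mul]
  rcases lt_or_gt_of_ne (show x ≠ 0 from hx) with h0 | h0
  · rw [exponentialPDF_of_neg h0, Set.indicator_of_notMem (by simpa using h0.le)]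
    simp
  · rw [exponentialPDF_of_nonneg h0.le, Set.indicator_of_mem (by simpa using h0),
      ENNReal.toReal_ofReal (by positivity)]

lemma ae_expMeasure_pos (q : ℝ) : ∀ᵐ Δ ∂expMeasure q, 0 < Δ := by
  have h1 : expMeasure q = volume.withDensity (exponentialPDF q) := rfl
  have hm : Measurable (exponentialPDF q) := (measurable_exponentialPDFReal q).ennreal_ofReal
  rw [h1, ae_withDensity_iff hm]
  filter_upwards [compl_mem_ae_iff.2 (measure_singleton (0 : ℝ))] with x hx hne
  rcases lt_or_gt_of_ne (show x ≠ 0 from hx) with h0 | h0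
  · exact absurd (exponentialPDF_of_neg h0) hne
  · exact h0

/-- Uniformization: if `φ` solves `φ' = q φ - q h` up to time `a`, then `φ 0` is the expectation
of `h`, evaluated at an exponential time of rate `q` and stopped at `a`. -/
lemma integral_expMeasure_eq {q a : ℝ} (hq : 0 < q) (ha : 0 ≤ a) {φ φ' : ℝ → ℝ}
    (hφ : ContinuousOn φ (Set.Icc 0 a)) (hφ' : ContinuousOn φ' (Set.Icc 0 a))
    (hd : ∀ Δ ∈ Set.Ioo 0 a, HasDerivAt φ (φ' Δ) Δ) :
    ∫ Δ, (if a ≤ Δ then φ a else φ Δ - φ' Δ / q) ∂expMeasure q = φ 0 := by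
  rw [integral_expMeasure hq, ← Set.Ioc_union_Ioi_eq_Ioi ha]
  have he : ContinuousOn (fun Δ => q * Real.exp (-(q * Δ)) * (φ Δ - φ' Δ / q)) (Set.Icc 0 a) := by
    fun_prop
  have e1 : ∫ Δ in Set.Ioc 0 a,
      q * Real.exp (-(q * Δ)) * (if a ≤ Δ then φ a else φ Δ - φ' Δ / q) =
      ∫ Δ in (0 : ℝ)..a, q * Real.exp (-(q * Δ)) * (φ Δ - φ' Δ / q) := by
    rw [intervalIntegral.integral_of_le ha, integral_Ioc_eq_integral_Ioo,
      integral_Ioc_eq_integral_Ioo]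
    refine setIntegral_congr_fun measurableSet_Ioo fun Δ hΔ => ?_
    simp only [if_neg (not_le.2 hΔ.2)]
  -- The combination `φ - φ' / q` is chosen so that the integrand is the derivative of `-exp (-qΔ)
  -- φ`. The boundary term at `a` then cancels against the tail integral beyond `a`.
  have e2 : ∫ Δ in (0 : ℝ)..a, q * Real.exp (-(q * Δ)) * (φ Δ - φ' Δ / q) =
      -(Real.exp (-(q * a)) * φ a) - -(Real.exp (-(q * 0)) * φ 0) := by
    refine intervalIntegral.integral_eq_sub_of_hasDerivAt_of_le ha
      (f := fun Δ => -(Real.exp (-(q * Δ)) * φ Δ)) (by fun_prop) (fun Δ hΔ => ?_) ?_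
    · have h1 : HasDerivAt (fun Δ : ℝ => Real.exp (-(q * Δ)))
          (Real.exp (-(q * Δ)) * (-(q * 1))) Δ :=
        (((hasDerivAt_id Δ).const_mul q).neg).exp
      refine ((h1.mul (hd Δ hΔ)).neg).congr_deriv ?_
      field_simp
      ring
    · exact ContinuousOn.intervalIntegrable_of_Icc ha he
  have e3 : Set.EqOn
      (fun Δ => q * Real.exp (-(q * Δ)) * (if a ≤ Δ then φ a else φ Δ - φ' Δ / q))
      (fun Δ => q * φ a * Real.exp (-q * Δ)) (Set.Ioi a) := by
    intro Δ hΔ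
    simp only [if_pos (le_of_lt (Set.mem_Ioi.1 hΔ)), neg_mul]
    ring
  have i3 : IntegrableOn (fun Δ => q * φ a * Real.exp (-q * Δ)) (Set.Ioi a) :=
    (exp_neg_integrableOn_Ioi a hq).const_mul _
  rw [setIntegral_union (by simp) measurableSet_Ioi ?_ ?_, e1, e2,
    setIntegral_congr_fun measurableSet_Ioi e3, integral_const_mul,
    integral_exp_mul_Ioi (by linarith)]
  · simp only [mul_zero, neg_zero, Real.exp_zero, neg_mul, one_mul]
    field_simp
    ring
  · refine (((he.integrableOn_Icc).mono_set Set.Ioo_subset_Icc_self).congr_fun ?_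
      measurableSet_Ioo).congr_set_ae Ioo_ae_eq_Ioc.symm
    intro Δ hΔ
    simp only [if_neg (not_le.2 hΔ.2)]
  · exact i3.congr_fun e3.symm measurableSet_Ioi

/-- The solution of `F' = ρ F - G` before time `T` with `F = R` from time `T` on. -/
noncomputable def backward (T ρ : ℝ) (G : ℝ → ℝ) (R t : ℝ) : ℝ :=
  Real.exp (ρ * min t T) * ((∫ u in min t T..T, Real.exp (-(ρ * u)) * G u) +
    Real.exp (-(ρ * T)) * R)

/-! ### The linear backward equation -/

section Backward

variable {T ρ R : ℝ} {G : ℝ → ℝ}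

lemma backward_of_le {t : ℝ} (ht : T ≤ t) : backward T ρ G R t = R := by
  simp [backward, min_eq_right ht, ← mul_assoc, ← Real.exp_add]

/-- The case in which no further event concerns the task; it starts the induction in
`iterValue_succ_eq`. -/
lemma backward_zero (t : ℝ) : backward T 0 (fun _ => 0) R t = R := by
  simp [backward]

lemma continuous_backward (hG : Continuous G) : Continuous (backward T ρ G R) := by
  have h1 : Continuous fun t => ∫ u in t..T, Real.exp (-(ρ * u)) * G u := by
    have h2 : Continuous fun t => ∫ u in T..t, Real.exp (-(ρ * u)) * G u :=
      intervalIntegral.continuous_primitive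
        (fun a b => Continuous.intervalIntegrable (by fun_prop) a b) T
    simp_rw [intervalIntegral.integral_symm T]
    exact h2.neg
  have h3 : Continuous fun t => ∫ u in min t T..T, Real.exp (-(ρ * u)) * G u :=
    h1.comp (f := fun t => min t T) (by fun_prop)
  unfold backward
  fun_prop

lemma hasDerivAt_backward (hG : Continuous G) {t : ℝ} (ht : t < T) :
    HasDerivAt (backward T ρ G R) (ρ * backward T ρ G R t - G t) t := by
  have hc : Continuous fun u => Real.exp (-(ρ * u)) * G u := by fun_prop
  have h1 : HasDerivAt (fun t => ∫ u in t..T, Real.exp (-(ρ * u)) * G u)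
      (-(Real.exp (-(ρ * t)) * G t)) t :=
    intervalIntegral.integral_hasDerivAt_left (hc.intervalIntegrable _ _)
      (hc.stronglyMeasurableAtFilter _ _) hc.continuousAt
  have h2 : HasDerivAt (fun t : ℝ => Real.exp (ρ * t)) (Real.exp (ρ * t) * (ρ * 1)) t :=
    ((hasDerivAt_id t).const_mul ρ).exp
  have h3 := h2.mul (h1.add_const (Real.exp (-(ρ * T)) * R))
  have h4 : backward T ρ G R =ᶠ[nhds t] (fun t : ℝ => Real.exp (ρ * t)) *
      fun t => (∫ u in t..T, Real.exp (-(ρ * u)) * G u) + Real.exp (-(ρ * T)) * R := by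
    filter_upwards [eventually_lt_nhds ht] with s hs
    simp [backward, min_eq_left hs.le]
  refine (h3.congr_of_eventuallyEq h4).congr_deriv ?_
  have h5 : Real.exp (ρ * t) * Real.exp (-(ρ * t)) = 1 := by
    rw [← Real.exp_add]; simp
  rw [backward, min_eq_left ht.le]
  linear_combination (-G t) * h5

/-- The constant `C` solves the equation with source `ρ * C` and terminal value `C`, and the
solution formula is monotone in source and terminal value. -/
lemma abs_backward_le {C : ℝ} (hG : Continuous G) (hGC : ∀ u, |G u| ≤ ρ * C) (hR : |R| ≤ C)
    (t : ℝ) : |backward T ρ G R t| ≤ C := by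
  set m := min t T with hm
  have hmT : m ≤ T := min_le_right _ _
  have hc : Continuous fun u => Real.exp (-(ρ * u)) * (ρ * C) := by fun_prop
  have h1 : ∫ u in m..T, Real.exp (-(ρ * u)) * (ρ * C) =
      -(Real.exp (-(ρ * T)) * C) - -(Real.exp (-(ρ * m)) * C) := by
    refine intervalIntegral.integral_eq_sub_of_hasDerivAt
      (f := fun u => -(Real.exp (-(ρ * u)) * C)) (fun u _ => ?_) (hc.intervalIntegrable _ _)
    have h1 : HasDerivAt (fun u : ℝ => Real.exp (-(ρ * u)))
        (Real.exp (-(ρ * u)) * (-(ρ * 1))) u :=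
      (((hasDerivAt_id u).const_mul ρ).neg).exp
    refine ((h1.mul_const C).neg).congr_deriv ?_
    ring
  have h2 : |∫ u in m..T, Real.exp (-(ρ * u)) * G u| ≤
      ∫ u in m..T, Real.exp (-(ρ * u)) * (ρ * C) := by
    refine (intervalIntegral.abs_integral_le_integral_abs hmT).trans
      (intervalIntegral.integral_mono_on hmT (Continuous.intervalIntegrable (by fun_prop) _ _)
        (hc.intervalIntegrable _ _) fun u _ => ?_)
    rw [abs_mul, abs_of_pos (Real.exp_pos _)]
    exact mul_le_mul_of_nonneg_left (hGC u) (Real.exp_pos _).le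
  have h5 : Real.exp (ρ * m) * Real.exp (-(ρ * m)) = 1 := by
    rw [← Real.exp_add]; simp
  rw [backward, ← hm, abs_mul, abs_of_pos (Real.exp_pos _)]
  calc Real.exp (ρ * m) * |(∫ u in m..T, Real.exp (-(ρ * u)) * G u) + Real.exp (-(ρ * T)) * R|
      ≤ Real.exp (ρ * m) * (Real.exp (-(ρ * m)) * C) := by
        refine mul_le_mul_of_nonneg_left ((abs_add_le _ _).trans ?_) (Real.exp_pos _).le
        have h6 : |Real.exp (-(ρ * T)) * R| ≤ Real.exp (-(ρ * T)) * C := by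
          rw [abs_mul, abs_of_pos (Real.exp_pos _)]
          exact mul_le_mul_of_nonneg_left hR (Real.exp_pos _).le
        linarith
    _ = C := by rw [← mul_assoc, h5, one_mul]

end Backward

lemma labelReward_mem_Icc (d : ℝ) {a b : ℝ} (ha : 0 < a) (hb : 0 < b) :
    labelReward d a b ∈ Set.Icc (0 : ℝ) 1 := by
  have := isProbabilityMeasureBeta ha hb
  exact ⟨le_max_of_le_left measureReal_nonneg, max_le measureReal_le_one measureReal_le_one⟩

namespace Model

variable {ι : Type*}

/-! ### The optimal value of one task -/

/-- The reward from task `x` after `k` positive and `j` negative labels. -/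
noncomputable def finalReward (M : Model ι) (x : ι) (k j : ℕ) : ℝ :=
  labelReward (M.d x) (M.α₀ x + k) (M.β₀ x + j)

/-- The probability of a positive label after `k` positive and `j` negative labels. -/
noncomputable def labelProb (M : Model ι) (x : ι) (k j : ℕ) : ℝ :=
  posProb (M.α₀ x + k) (M.β₀ x + j)

/-- The price of the worker who enters when `ℓ` workers have entered already. -/
noncomputable def price (M : Model ι) (lam : Fin M.U → ℝ) (ℓ : ℕ) : ℝ :=
  if h : ℓ < M.U then lam ⟨ℓ, h⟩ else 0

/-- The rate of the events that concern a task with `w` workers when `ℓ` workers have entered. -/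
noncomputable def taskRate (M : Model ι) (ℓ w : ℕ) : ℝ :=
  (if ℓ < M.U then M.r else 0) + M.μ * w

/-- The expected gain per unit of time from the events that concern task `x`, for the value
function `V` and optimal allocation. -/
noncomputable def gain (M : Model ι) (x : ι) (lam : Fin M.U → ℝ)
    (V : ℕ → ℕ → ℕ → ℕ → ℝ → ℝ) (ℓ w k j : ℕ) (u : ℝ) : ℝ :=
  (if ℓ < M.U then
    M.r * max (V (ℓ + 1) w k j u) (V (ℓ + 1) (w + 1) k j u - M.price lam ℓ) else 0) +
  M.μ * w * (M.labelProb x k j * V ℓ (w - 1) (k + 1) j u +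
    (1 - M.labelProb x k j) * V ℓ (w - 1) k (j + 1) u)

/-- The optimal value of task `x` when at most `m` events that concern it are considered. -/
noncomputable def iterValue (M : Model ι) (x : ι) (lam : Fin M.U → ℝ) :
    ℕ → ℕ → ℕ → ℕ → ℕ → ℝ → ℝ
  | 0 => fun _ _ k j _ => M.finalReward x k j
  | m + 1 => fun ℓ w k j =>
      backward M.T (M.taskRate ℓ w) (M.gain x lam (iterValue M x lam m) ℓ w k j)
        (M.finalReward x k j)

/-- The optimal value of the penalized problem for task `x`, from time `t` on, when `ℓ` workers
have entered, `w` of them are working on the task and `k` positive and `j` negative labels have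
been received. -/
noncomputable def taskValue (M : Model ι) (x : ι) (lam : Fin M.U → ℝ) (ℓ w : ℕ) :
    ℕ → ℕ → ℝ → ℝ :=
  -- An upper bound for the number of remaining events that concern the task: every worker still to
  -- come counts for an arrival and a completion, every active worker for a completion.
  M.iterValue x lam (2 * (M.U - ℓ) + w) ℓ w

variable (M : Model ι) (x : ι) (lam : Fin M.U → ℝ)

lemma iterValue_succ (m ℓ w k j : ℕ) : M.iterValue x lam (m + 1) ℓ w k j =
    backward M.T (M.taskRate ℓ w) (M.gain x lam (M.iterValue x lam m) ℓ w k j)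
      (M.finalReward x k j) := rfl

lemma finalReward_mem_Icc (k j : ℕ) : M.finalReward x k j ∈ Set.Icc (0 : ℝ) 1 := by
  have h1 := M.α₀_pos x
  have h2 := M.β₀_pos x
  exact labelReward_mem_Icc _ (by positivity) (by positivity)

lemma abs_finalReward_le (k j : ℕ) : |M.finalReward x k j| ≤ 1 := by
  rw [abs_of_nonneg (M.finalReward_mem_Icc x k j).1]
  exact (M.finalReward_mem_Icc x k j).2

lemma abs_price_le (ℓ : ℕ) : |M.price lam ℓ| ≤ ∑ i, |lam i| := by
  unfold price
  split_ifs with h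
  · exact Finset.single_le_sum (f := fun i => |lam i|) (fun i _ => abs_nonneg _)
      (Finset.mem_univ _)
  · rw [abs_zero]
    exact Finset.sum_nonneg fun i _ => abs_nonneg _

lemma continuous_gain {V : ℕ → ℕ → ℕ → ℕ → ℝ → ℝ} (hV : ∀ ℓ w k j, Continuous (V ℓ w k j))
    (ℓ w k j : ℕ) : Continuous (M.gain x lam V ℓ w k j) := by
  unfold gain
  split_ifs <;> fun_prop

lemma continuous_iterValue (m ℓ w k j : ℕ) : Continuous (M.iterValue x lam m ℓ w k j) := by
  induction m generalizing ℓ w k j with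
  | zero => exact continuous_const
  | succ m ih => exact continuous_backward (M.continuous_gain x lam ih ℓ w k j)

lemma continuous_taskValue (ℓ w k j : ℕ) : Continuous (M.taskValue x lam ℓ w k j) :=
  M.continuous_iterValue x lam _ ℓ w k j

/-- The gain reads `V` only at the neighbours reached by one event. At `w = 0` the truncated `w - 1`
is harmless, because the factor `w` removes that term. -/
lemma gain_congr {V V' : ℕ → ℕ → ℕ → ℕ → ℝ → ℝ} {ℓ w : ℕ}
    (h1 : ℓ < M.U → V (ℓ + 1) w = V' (ℓ + 1) w)
    (h2 : ℓ < M.U → V (ℓ + 1) (w + 1) = V' (ℓ + 1) (w + 1))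
    (h3 : w ≠ 0 → V ℓ (w - 1) = V' ℓ (w - 1)) :
    M.gain x lam V ℓ w = M.gain x lam V' ℓ w := by
  funext k j u
  unfold gain
  congr 1
  · split_ifs with h
    · rw [h1 h, h2 h]
    · rfl
  · by_cases h : w = 0
    · simp [h]
    · rw [h3 h]

/-- Each relevant event lowers `2 * (U - ℓ) + w`: a completion or an arrival with assignment by one,
an arrival without assignment by two. So the iteration is stationary from this index on. -/
lemma iterValue_succ_eq {m ℓ w : ℕ} (h : 2 * (M.U - ℓ) + w ≤ m) :
    M.iterValue x lam (m + 1) ℓ w = M.iterValue x lam m ℓ w := by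
  induction m generalizing ℓ w with
  | zero =>
    have hw : w = 0 := by omega
    have hℓ : ¬ ℓ < M.U := by omega
    funext k j t
    have h0 : M.gain x lam (M.iterValue x lam 0) ℓ w k j = fun _ => 0 := by
      funext u; simp [gain, hw, hℓ]
    have h1 : M.taskRate ℓ w = 0 := by simp [taskRate, hw, hℓ]
    simp only [iterValue] at h0 ⊢
    rw [h0, h1, backward_zero]
  | succ m ih =>
    have key : M.gain x lam (M.iterValue x lam (m + 1)) ℓ w =
        M.gain x lam (M.iterValue x lam m) ℓ w :=
      M.gain_congr x lam (fun _ => ih (by omega)) (fun _ => ih (by omega)) fun _ => ih (by omega)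
    funext k j
    rw [iterValue_succ, key, iterValue_succ]

lemma iterValue_eq_taskValue {m ℓ w : ℕ} (h : 2 * (M.U - ℓ) + w ≤ m) :
    M.iterValue x lam m ℓ w = M.taskValue x lam ℓ w := by
  induction m, h using Nat.le_induction with
  | base => rfl
  | succ m hm ih => rw [M.iterValue_succ_eq x lam hm, ih]

/-- The Bellman equation. -/
lemma taskValue_eq (ℓ w k j : ℕ) :
    M.taskValue x lam ℓ w k j = backward M.T (M.taskRate ℓ w)
      (M.gain x lam (M.taskValue x lam) ℓ w k j) (M.finalReward x k j) := by
  -- One surplus iteration costs nothing, and after it is unfolded all neighbours carry the same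
  -- index, which suffices for each of them.
  rw [← M.iterValue_eq_taskValue x lam (Nat.le_succ _), iterValue_succ,
    M.gain_congr x lam (fun _ => M.iterValue_eq_taskValue x lam (by omega))
      (fun _ => M.iterValue_eq_taskValue x lam (by omega))
      (fun _ => M.iterValue_eq_taskValue x lam (by omega))]

lemma taskValue_of_le (ℓ w k j : ℕ) {t : ℝ} (ht : M.T ≤ t) :
    M.taskValue x lam ℓ w k j t = M.finalReward x k j := by
  rw [taskValue_eq, backward_of_le ht]

lemma hasDerivAt_taskValue (ℓ w k j : ℕ) {t : ℝ} (ht : t < M.T) :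
    HasDerivAt (M.taskValue x lam ℓ w k j)
      (M.taskRate ℓ w * M.taskValue x lam ℓ w k j t -
        M.gain x lam (M.taskValue x lam) ℓ w k j t) t := by
  have h := hasDerivAt_backward (ρ := M.taskRate ℓ w) (R := M.finalReward x k j)
    (M.continuous_gain x lam (M.continuous_taskValue x lam) ℓ w k j) ht
  rwa [← taskValue_eq] at h

/-- The bound has the form `ρ * C'` that `abs_backward_le` takes, so one iteration enlarges the
bound by at most one full set of prices. -/
lemma abs_gain_le {V : ℕ → ℕ → ℕ → ℕ → ℝ → ℝ} {C : ℝ} (hV : ∀ ℓ w k j u, |V ℓ w k j u| ≤ C)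
    (ℓ w k j : ℕ) (u : ℝ) :
    |M.gain x lam V ℓ w k j u| ≤ M.taskRate ℓ w * (C + ∑ i, |lam i|) := by
  have hr := M.r_pos
  have hμ := M.μ_pos
  have hL : 0 ≤ ∑ i, |lam i| := Finset.sum_nonneg fun i _ => abs_nonneg _
  have hp0 : 0 ≤ M.labelProb x k j := posProb_nonneg _ _
  have hp1 : 0 ≤ 1 - M.labelProb x k j := sub_nonneg.2 (posProb_le_one _ _)
  unfold gain taskRate
  rw [add_mul]
  refine (abs_add_le _ _).trans (add_le_add ?_ ?_)
  · split_ifs with h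
    · rw [abs_mul, abs_of_pos hr]
      refine mul_le_mul_of_nonneg_left (abs_max_le_max_abs_abs.trans (max_le ?_ ?_)) hr.le
      · linarith [hV (ℓ + 1) w k j u]
      · linarith [hV (ℓ + 1) (w + 1) k j u, M.abs_price_le lam ℓ,
          abs_sub (V (ℓ + 1) (w + 1) k j u) (M.price lam ℓ)]
    · simp
  · rw [abs_mul, abs_of_nonneg (by positivity : 0 ≤ M.μ * (w : ℝ))]
    refine mul_le_mul_of_nonneg_left ((abs_add_le _ _).trans ?_) (by positivity)
    rw [abs_mul, abs_mul, abs_of_nonneg hp0, abs_of_nonneg hp1]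
    have h1 := mul_le_mul_of_nonneg_left (hV ℓ (w - 1) (k + 1) j u) hp0
    have h2 := mul_le_mul_of_nonneg_left (hV ℓ (w - 1) k (j + 1) u) hp1
    linarith

lemma abs_iterValue_le (m ℓ w k j : ℕ) (u : ℝ) :
    |M.iterValue x lam m ℓ w k j u| ≤ 1 + m * ∑ i, |lam i| := by
  have hL : 0 ≤ ∑ i, |lam i| := Finset.sum_nonneg fun i _ => abs_nonneg _
  induction m generalizing ℓ w k j u with
  | zero => simpa [iterValue] using M.abs_finalReward_le x k j
  | succ m ih =>
    have h : (1 + (m + 1 : ℕ) * ∑ i, |lam i|) = (1 + m * ∑ i, |lam i|) + ∑ i, |lam i| := by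
      push_cast; ring
    rw [h]
    refine abs_backward_le (M.continuous_gain x lam (M.continuous_iterValue x lam m) ℓ w k j)
      (M.abs_gain_le x lam ih ℓ w k j) ((M.abs_finalReward_le x k j).trans ?_) u
    have : 0 ≤ (m : ℝ) * ∑ i, |lam i| := by positivity
    linarith

lemma abs_taskValue_le {ℓ w : ℕ} (hw : w ≤ M.U) (k j : ℕ) (u : ℝ) :
    |M.taskValue x lam ℓ w k j u| ≤ 1 + (3 * M.U : ℕ) * ∑ i, |lam i| := by
  have hL : 0 ≤ ∑ i, |lam i| := Finset.sum_nonneg fun i _ => abs_nonneg _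
  refine (M.abs_iterValue_le x lam _ ℓ w k j u).trans ?_
  gcongr
  -- The iteration index is at most `2 * U + U`, since `w ≤ U`.
  omega

/-! ### The value as a function of the state -/

/-- The number of positive labels that task `x` has received. -/
noncomputable def positives (s : State ι) : ℕ := ⌊s.alpha x - M.α₀ x⌋₊

/-- The number of negative labels that task `x` has received. -/
noncomputable def negatives (s : State ι) : ℕ := ⌊s.beta x - M.β₀ x⌋₊

@[fun_prop] lemma measurable_positives : Measurable (M.positives x) := by
  unfold positives; fun_prop

@[fun_prop] lemma measurable_negatives : Measurable (M.negatives x) := by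
  unfold negatives; fun_prop

/-- The optimal value of task `x` in a state of the full system. -/
noncomputable def stateValue (s : State ι) : ℝ :=
  M.taskValue x lam s.count (s.work x) (M.positives x s) (M.negatives x s) s.time

/-- Only time is a continuous variable of the value; the other parameters are natural numbers. -/
lemma measurable_of_countable_of_continuous {α β : Type*} [MeasurableSpace α] [MeasurableSpace β]
    [Countable β] [MeasurableSingletonClass β] {F : β → ℝ → ℝ} (hF : ∀ b, Continuous (F b))
    {b : α → β} {t : α → ℝ} (hb : Measurable b) (ht : Measurable t) :
    Measurable fun a => F (b a) (t a) :=
  (measurable_from_prod_countable_right (f := fun p : β × ℝ => F p.1 p.2)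
    fun b => (hF b).measurable).comp (hb.prodMk ht)

lemma measurable_taskValue {α : Type*} [MeasurableSpace α] {ℓ w k j : α → ℕ} {t : α → ℝ}
    (hℓ : Measurable ℓ) (hw : Measurable w) (hk : Measurable k) (hj : Measurable j)
    (ht : Measurable t) :
    Measurable fun a => M.taskValue x lam (ℓ a) (w a) (k a) (j a) (t a) :=
  measurable_of_countable_of_continuous
    (F := fun b : ℕ × ℕ × ℕ × ℕ => M.taskValue x lam b.1 b.2.1 b.2.2.1 b.2.2.2)
    (fun _ => M.continuous_taskValue x lam _ _ _ _) (hℓ.prodMk (hw.prodMk (hk.prodMk hj))) ht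

@[fun_prop] lemma measurable_stateValue : Measurable (M.stateValue x lam) :=
  M.measurable_taskValue x lam (by fun_prop) (by fun_prop) (by fun_prop) (by fun_prop)
    (by fun_prop)

end Model

namespace Model

variable {ι : Type*} [Fintype ι] [DecidableEq ι] (M : Model ι) (π : Policy ι)

/-! ### One step of the chain -/

lemma jumpLaw_of_le {p : State ι × ℝ} (h : M.T ≤ p.1.time + p.2) :
    M.jumpLaw π p = Measure.dirac (cancelled p) := if_pos h

/-- The law is a finite combination of point masses, so `P` need not be measurable. Completions at
idle tasks have weight zero, hence the condition `work y ≠ 0`. -/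
lemma ae_jumpLaw {p : State ι × ℝ} {P : State ι → Prop}
    (h0 : M.T ≤ p.1.time + p.2 → P (cancelled p))
    (h1 : p.1.time + p.2 < M.T → P (M.arrival π p))
    (h2 : p.1.time + p.2 < M.T → ∀ y, p.1.work y ≠ 0 → P (positive y p) ∧ P (negative y p)) :
    ∀ᵐ s' ∂M.jumpLaw π p, P s' := by
  have hdirac : ∀ (c : ℝ≥0∞) (a : State ι), (c ≠ 0 → P a) →
      ∀ᵐ s' ∂(c • Measure.dirac a), P s' := by
    intro c a h
    rcases eq_or_ne c 0 with rfl | hc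
    · simp
    · exact Measure.ae_smul_measure (by rw [ae_dirac_eq]; exact h hc) c
  unfold jumpLaw
  split_ifs with hT
  · rw [ae_dirac_eq]; exact h0 hT
  · rw [not_le] at hT
    rw [ae_add_measure_iff]
    refine ⟨hdirac _ _ fun _ => h1 hT, ?_⟩
    rw [ae_iff, Measure.finsetSum_apply]
    refine Finset.sum_eq_zero fun y _ => ?_
    rw [← ae_iff, ae_add_measure_iff]
    have hw : ∀ c : ℝ, ENNReal.ofReal (c * (M.μ * p.1.work y / M.rate p.1)) ≠ 0 →
        p.1.work y ≠ 0 := by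
      intro c hc h
      simp [h] at hc
    exact ⟨hdirac _ _ fun hc => (h2 hT y (hw _ hc)).1, hdirac _ _ fun hc => (h2 hT y (hw _ hc)).2⟩

lemma integral_jumpLaw (p : State ι × ℝ) (g : State ι → ℝ) :
    ∫ s', g s' ∂M.jumpLaw π p = if M.T ≤ p.1.time + p.2 then g (cancelled p) else
      M.r / M.rate p.1 * g (M.arrival π p) +
      ∑ y, M.μ * p.1.work y / M.rate p.1 *
        (posProb (p.1.alpha y) (p.1.beta y) * g (positive y p) +
          (1 - posProb (p.1.alpha y) (p.1.beta y)) * g (negative y p)) := by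
  have hi : ∀ (c : ℝ) (a : State ι), Integrable g (ENNReal.ofReal c • Measure.dirac a) :=
    fun c a => (integrable_dirac (by finiteness)).smul_measure ENNReal.ofReal_ne_top
  have hd : ∀ (c : ℝ) (a : State ι), 0 ≤ c →
      ∫ s', g s' ∂(ENNReal.ofReal c • Measure.dirac a) = c * g a := by
    intro c a hc
    rw [integral_smul_measure, integral_dirac, ENNReal.toReal_ofReal hc, smul_eq_mul]
  have hq := M.rate_pos p.1
  have hμ := M.μ_pos
  have hr := M.r_pos
  unfold jumpLaw
  split_ifs with hT
  · rw [integral_dirac]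
  · rw [integral_add_measure (hi _ _)
        (integrable_finsetSum_measure.2 fun y _ => (hi _ _).add_measure (hi _ _)),
      hd _ _ (by positivity), integral_finsetSum_measure fun y _ => (hi _ _).add_measure (hi _ _)]
    congr 1
    refine Finset.sum_congr rfl fun y _ => ?_
    have h1 := posProb_nonneg (p.1.alpha y) (p.1.beta y)
    have h2 := sub_nonneg.2 (posProb_le_one (p.1.alpha y) (p.1.beta y))
    rw [integral_add_measure (hi _ _) (hi _ _), hd _ _ (by positivity), hd _ _ (by positivity)]
    ring

lemma transition_apply (s : State ι) {A : Set (State ι)} (hA : MeasurableSet A) :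
    M.transition π s A = ∫⁻ Δ, M.jumpLaw π (s, Δ) A ∂expMeasure (M.rate s) := by
  rw [transition, Kernel.comp_apply' _ _ _ hA, Kernel.prod_apply, Kernel.id_apply]
  rw [Measure.dirac_prod, lintegral_map ((M.jumpKernel π).measurable_coe hA) (by fun_prop)]
  rfl

lemma integral_transition (s : State ι) {g : State ι → ℝ}
    (hg : Integrable g (M.transition π s)) :
    ∫ s', g s' ∂M.transition π s =
      ∫ Δ, ∫ s', g s' ∂M.jumpLaw π (s, Δ) ∂expMeasure (M.rate s) := by
  rw [transition] at hg ⊢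
  have hm : AEStronglyMeasurable (fun p => ∫ s', g s' ∂M.jumpKernel π p)
      ((Kernel.id ×ₖ M.delayKernel) s) := hg.integral_comp.aestronglyMeasurable
  rw [Kernel.integral_comp hg]
  rw [Kernel.prod_apply, Kernel.id_apply, Measure.dirac_prod] at hm ⊢
  rw [integral_map (by fun_prop) hm]
  rfl

lemma integrable_integral_jumpLaw (s : State ι) {g : State ι → ℝ}
    (hg : Integrable g (M.transition π s)) :
    Integrable (fun Δ => ∫ s', g s' ∂M.jumpLaw π (s, Δ)) (expMeasure (M.rate s)) := by
  rw [transition] at hg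
  have h := hg.integral_comp
  rw [Kernel.prod_apply, Kernel.id_apply, Measure.dirac_prod] at h
  exact h.comp_measurable (by fun_prop)

lemma ae_transition {s : State ι} {P : State ι → Prop} (hP : MeasurableSet {s' | P s'})
    (h : ∀ Δ : ℝ, 0 < Δ → ∀ᵐ s' ∂M.jumpLaw π (s, Δ), P s') : ∀ᵐ s' ∂M.transition π s, P s' := by
  change M.transition π s {s' | P s'}ᶜ = 0
  rw [M.transition_apply π s hP.compl]
  refine (lintegral_congr_ae ?_).trans lintegral_zero
  filter_upwards [ae_expMeasure_pos (M.rate s)] with Δ hΔ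
  exact ae_iff.1 (h Δ hΔ)

/-! ### The law of the chain -/

instance : IsProbabilityMeasure (M.law π) := by
  unfold law; infer_instance

/-- The Markov property in the only form needed below: two consecutive states. The history kernel
depends on the last coordinate alone, so it suffices to test the general identity on sets that read
that coordinate. -/
lemma law_map_pair (n : ℕ) :
    (M.law π).map (fun S => (S n, S (n + 1))) =
      ((M.law π).map fun S => S n) ⊗ₘ M.transition π := by
  have h := Kernel.map_frestrictLe_trajMeasure_compProd_eq_map_trajMeasure
    (X := fun _ => State ι) (μ₀ := Measure.dirac M.initial) (a := n)
    (κ := fun n => (M.transition π).comap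
      (fun h : (i : Finset.Iic n) → State ι => h ⟨n, Finset.mem_Iic.2 le_rfl⟩)
      (measurable_pi_apply _))
  have hm : Measurable fun S : ℕ → State ι => Preorder.frestrictLe (π := fun _ => State ι) n S := by
    fun_prop
  ext A hA
  rw [Measure.map_apply (by fun_prop) hA, Measure.compProd_apply hA,
    lintegral_map (Kernel.measurable_kernel_prodMk_left hA) (by fun_prop)]
  have hA' : MeasurableSet {p : ((i : Finset.Iic n) → State ι) × State ι |
      (p.1 ⟨n, Finset.mem_Iic.2 le_rfl⟩, p.2) ∈ A} := by
    refine measurableSet_preimage ?_ hA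
    fun_prop
  have h2 := congrArg (fun ν => ν {p : ((i : Finset.Iic n) → State ι) × State ι |
      (p.1 ⟨n, Finset.mem_Iic.2 le_rfl⟩, p.2) ∈ A}) h
  rw [Measure.compProd_apply hA', lintegral_map (Kernel.measurable_kernel_prodMk_left hA') hm,
    Measure.map_apply (by fun_prop) hA'] at h2
  exact h2.symm

lemma ae_law_zero : ∀ᵐ S ∂M.law π, S 0 = M.initial := by
  have h : (M.law π).map (Preorder.frestrictLe (π := fun _ => State ι) 0) =
      (Measure.dirac M.initial).map
        (MeasurableEquiv.piUnique fun _ : Finset.Iic 0 => State ι).symm := by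
    rw [law, Kernel.trajMeasure, Measure.map_comp _ _ (by fun_prop), Kernel.traj_map_frestrictLe,
      Kernel.partialTraj_self, Measure.id_comp]
  replace h := h.trans (Measure.map_dirac' (MeasurableEquiv.measurable _) _)
  have h1 : ∀ᵐ f ∂(M.law π).map (Preorder.frestrictLe (π := fun _ => State ι) 0),
      f ⟨0, Finset.mem_Iic.2 le_rfl⟩ = M.initial := by
    rw [h, ae_dirac_iff (measurableSet_eq_fun (by fun_prop) (by fun_prop))]
    rfl
  exact ae_of_ae_map (by fun_prop) h1

lemma ae_law_pair {n : ℕ} {P : State ι × State ι → Prop} (hP : MeasurableSet {p | P p})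
    (h : ∀ᵐ S ∂M.law π, ∀ᵐ s' ∂M.transition π (S n), P (S n, s')) :
    ∀ᵐ S ∂M.law π, P (S n, S (n + 1)) := by
  have h1 : ∀ᵐ p ∂((M.law π).map fun S => S n) ⊗ₘ M.transition π, P p := by
    refine Measure.ae_compProd_of_ae_ae hP ?_
    rw [ae_map_iff (f := fun S : ℕ → State ι => S n) (Measurable.aemeasurable (by fun_prop))]
    · exact h
    · have h2 := Kernel.measurable_kernel_prodMk_left (κ := M.transition π) hP.compl
      exact h2 (measurableSet_singleton 0)
  rw [← law_map_pair] at h1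
  exact ae_of_ae_map (by fun_prop) h1

lemma integral_law_pair {n : ℕ} {g : State ι × State ι → ℝ} (hm : Measurable g)
    (hg : Integrable (fun S => g (S n, S (n + 1))) (M.law π)) :
    ∫ S, g (S n, S (n + 1)) ∂M.law π =
      ∫ S, ∫ s', g (S n, s') ∂M.transition π (S n) ∂M.law π := by
  have hp : Measurable fun S : ℕ → State ι => (S n, S (n + 1)) := by fun_prop
  rw [← integral_map (f := g) (φ := fun S : ℕ → State ι => (S n, S (n + 1))) hp.aemeasurable
      hm.aestronglyMeasurable]
  have h1 : Integrable g ((M.law π).map fun S => (S n, S (n + 1))) :=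
    (integrable_map_measure hm.aestronglyMeasurable hp.aemeasurable).2 hg
  rw [law_map_pair] at h1 ⊢
  rw [Measure.integral_compProd h1,
    integral_map (measurable_pi_apply n).aemeasurable
      (MeasureTheory.Integrable.integral_compProd h1).aestronglyMeasurable]

end Model

namespace Model

variable {ι : Type*}

/-! ### Almost sure properties of the chain -/

/-- The states that can be reached. -/
def Consistent (M : Model ι) (s : State ι) : Prop :=
  0 ≤ s.time ∧ s.count ≤ M.U ∧ ∀ y, s.alpha y = M.α₀ y + M.positives y s ∧
    s.beta y = M.β₀ y + M.negatives y s ∧ s.work y ≤ s.count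

/-- The properties of the transitions that are used below. -/
def Step (M : Model ι) (s s' : State ι) : Prop :=
  s.time ≤ s'.time ∧ (s'.count = s.count ∨ s'.count = s.count + 1 ∧ s.count < M.U) ∧
    (s ∈ M.terminal → s' ∈ M.terminal ∧ s'.alpha = s.alpha ∧ s'.beta = s.beta) ∧
    (M.T ≤ s.time → s'.count = s.count)

/-- The trajectories that start in the initial state and visit reachable states only. -/
def IsPath (M : Model ι) (S : ℕ → State ι) : Prop :=
  S 0 = M.initial ∧ ∀ n, M.Consistent (S n) ∧ M.Step (S n) (S (n + 1))

variable (M : Model ι)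

lemma positives_eq {y : ι} {s : State ι} {k : ℕ} (h : s.alpha y = M.α₀ y + k) :
    M.positives y s = k := by
  simp [positives, h]

lemma negatives_eq {y : ι} {s : State ι} {k : ℕ} (h : s.beta y = M.β₀ y + k) :
    M.negatives y s = k := by
  simp [negatives, h]

/-- When the parameters differ from the priors by natural numbers, the floors in `positives` and
`negatives` recover these numbers exactly. -/
lemma consistent_of_exists {s : State ι} (h0 : 0 ≤ s.time) (hU : s.count ≤ M.U)
    (h : ∀ y, (∃ k : ℕ, s.alpha y = M.α₀ y + k) ∧ (∃ j : ℕ, s.beta y = M.β₀ y + j) ∧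
      s.work y ≤ s.count) : M.Consistent s := by
  refine ⟨h0, hU, fun y => ?_⟩
  obtain ⟨⟨k, hk⟩, ⟨j, hj⟩, hw⟩ := h y
  exact ⟨by rw [M.positives_eq hk, hk], by rw [M.negatives_eq hj, hj], hw⟩

lemma consistent_initial : M.Consistent M.initial :=
  M.consistent_of_exists le_rfl (Nat.zero_le _) fun y =>
    ⟨⟨0, by simp [initial, State.alpha]⟩, ⟨0, by simp [initial, State.beta]⟩, le_rfl⟩

section Measurability

variable [Fintype ι]

lemma measurableSet_consistent : MeasurableSet {s | M.Consistent s} := by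
  have h1 : ∀ y, Measurable fun s : State ι => s.alpha y := fun y => by fun_prop
  have h2 : ∀ y, Measurable fun s : State ι => s.beta y := fun y => by fun_prop
  have h3 : ∀ y, Measurable fun s : State ι => s.work y := fun y => by fun_prop
  have h4 : ∀ y, Measurable fun s : State ι => M.α₀ y + (M.positives y s : ℝ) := fun y =>
    (measurable_of_countable (fun n : ℕ => M.α₀ y + (n : ℝ))).comp (M.measurable_positives y)
  have h5 : ∀ y, Measurable fun s : State ι => M.β₀ y + (M.negatives y s : ℝ) := fun y =>
    (measurable_of_countable (fun n : ℕ => M.β₀ y + (n : ℝ))).comp (M.measurable_negatives y)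
  have h : MeasurableSet ({s : State ι | 0 ≤ s.time} ∩ ({s : State ι | s.count ≤ M.U} ∩
      ⋂ y, ({s : State ι | s.alpha y = M.α₀ y + M.positives y s} ∩
        ({s : State ι | s.beta y = M.β₀ y + M.negatives y s} ∩
          {s : State ι | s.work y ≤ s.count})))) :=
    (measurableSet_le measurable_const State.measurable_time).inter
      ((measurableSet_le State.measurable_count measurable_const).inter
        (MeasurableSet.iInter fun y => (measurableSet_eq_fun (h1 y) (h4 y)).inter
          ((measurableSet_eq_fun (h2 y) (h5 y)).inter
            (measurableSet_le (h3 y) State.measurable_count))))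
  convert h using 1
  ext s
  simp [Consistent]

lemma measurableSet_terminal : MeasurableSet M.terminal :=
  (measurableSet_le measurable_const State.measurable_time).union
    ((measurableSet_le measurable_const State.measurable_count).inter
      (measurableSet_eq_fun State.measurable_work measurable_const))

lemma measurableSet_step : MeasurableSet {p : State ι × State ι | M.Step p.1 p.2} := by
  have ht := M.measurableSet_terminal
  have h1 : MeasurableSet {p : State ι × State ι | p.1 ∈ M.terminal} := ht.preimage (by fun_prop)
  have h2 : MeasurableSet {p : State ι × State ι | p.2 ∈ M.terminal} := ht.preimage (by fun_prop)
  have h3 : MeasurableSet {p : State ι × State ι | p.2.count = p.1.count} :=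
    measurableSet_eq_fun (by fun_prop) (by fun_prop)
  have h4 : MeasurableSet {p : State ι × State ι | p.2.count = p.1.count + 1} :=
    measurableSet_eq_fun (by fun_prop) (by fun_prop)
  have h5 : MeasurableSet {p : State ι × State ι | p.1.count < M.U} :=
    measurableSet_lt (by fun_prop) (by fun_prop)
  have h6 : MeasurableSet {p : State ι × State ι | p.2.alpha = p.1.alpha} :=
    measurableSet_eq_fun (by fun_prop) (by fun_prop)
  have h7 : MeasurableSet {p : State ι × State ι | p.2.beta = p.1.beta} :=
    measurableSet_eq_fun (by fun_prop) (by fun_prop)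
  have h8 : MeasurableSet {p : State ι × State ι | M.T ≤ p.1.time} :=
    measurableSet_le (by fun_prop) (by fun_prop)
  have h9 : MeasurableSet {p : State ι × State ι | p.1.time ≤ p.2.time} :=
    measurableSet_le (by fun_prop) (by fun_prop)
  exact h9.inter ((h3.union (h4.inter h5)).inter
    ((h1.himp (h2.inter (h6.inter h7))).inter (h8.himp h3)))

lemma measurableSet_consistent_imp_step : MeasurableSet
    {p : State ι × State ι | M.Consistent p.1 → M.Consistent p.2 ∧ M.Step p.1 p.2} := by
  have hc := M.measurableSet_consistent
  have h1 : MeasurableSet {p : State ι × State ι | M.Consistent p.1} := hc.preimage (by fun_prop)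
  have h2 : MeasurableSet {p : State ι × State ι | M.Consistent p.2} := hc.preimage (by fun_prop)
  exact h1.himp (h2.inter M.measurableSet_step)

end Measurability

variable [Fintype ι] [DecidableEq ι] (π : Policy ι)

lemma ae_jumpLaw_step {s : State ι} (hs : M.Consistent s) {Δ : ℝ} (hΔ : 0 < Δ) :
    ∀ᵐ s' ∂M.jumpLaw π (s, Δ), M.Consistent s' ∧ M.Step s s' := by
  obtain ⟨h0, hU, hy⟩ := hs
  have ht : 0 ≤ s.time + Δ := by positivity
  have hlab : ∀ y, (∃ k : ℕ, s.alpha y = M.α₀ y + k) ∧ (∃ j : ℕ, s.beta y = M.β₀ y + j) :=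
    fun y => ⟨⟨_, (hy y).1⟩, ⟨_, (hy y).2.1⟩⟩
  -- If the next event precedes the horizon, a terminal state can only be one with exhausted budget
  -- and no active worker.
  have hterm : s.time + Δ < M.T → s ∈ M.terminal → M.U ≤ s.count ∧ s.work = 0 := by
    rintro h (h' | h')
    · linarith
    · exact h'
  refine M.ae_jumpLaw π (fun hT => ?_) (fun hT => ?_) fun hT y hw => ?_
  · refine ⟨M.consistent_of_exists ht hU fun y => ⟨(hlab y).1, (hlab y).2, Nat.zero_le _⟩, ?_,
      Or.inl rfl, fun _ => ⟨Or.inl hT, rfl, rfl⟩, fun _ => rfl⟩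
    change s.time ≤ s.time + Δ
    linarith
  · unfold arrival
    dsimp only at hT ⊢
    split_ifs with h
    · refine ⟨M.consistent_of_exists ht h fun y => ⟨(hlab y).1, (hlab y).2, ?_⟩, ?_,
        Or.inr ⟨rfl, h⟩, fun hs => ?_, fun hs => ?_⟩
      -- An arrival adds at most one worker to each task and exactly one to the count, so the
      -- invariant holds even for infeasible policies.
      · exact Nat.add_le_add (hy y).2.2 (Nat.lt_succ_iff.1 (Fin.is_lt _))
      · change s.time ≤ s.time + Δ
        linarith
      · exact absurd (hterm hT hs).1 (not_le.2 h)
      · linarith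
    · refine ⟨M.consistent_of_exists ht hU fun y => ⟨(hlab y).1, (hlab y).2, (hy y).2.2⟩, ?_,
        Or.inl rfl, fun hs => ⟨Or.inr (hterm hT hs), rfl, rfl⟩, fun _ => rfl⟩
      change s.time ≤ s.time + Δ
      linarith
  · dsimp only at hT hw
    have hnt : s ∉ M.terminal := fun hs => hw (by rw [(hterm hT hs).2]; rfl)
    have hwork : ∀ z, (s.work - Pi.single y 1 : ι → ℕ) z ≤ s.count := fun z =>
      (Nat.sub_le _ _).trans (hy z).2.2
    have hincr : ∀ (f g : ι → ℝ) (z : ι), (∃ k : ℕ, f z = g z + k) →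
        ∃ k : ℕ, (f + Pi.single y 1 : ι → ℝ) z = g z + k := by
      rintro f g z ⟨k, hk⟩
      by_cases hz : z = y
      · subst hz
        exact ⟨k + 1, by simp [hk, add_assoc]⟩
      · exact ⟨k, by simp [hk, hz]⟩
    have htime : s.time ≤ s.time + Δ := by linarith
    exact ⟨⟨M.consistent_of_exists ht hU fun z =>
          ⟨hincr _ _ z (hlab z).1, (hlab z).2, hwork z⟩,
        htime, Or.inl rfl, fun hs => absurd hs hnt, fun _ => rfl⟩,
      ⟨M.consistent_of_exists ht hU fun z =>
          ⟨(hlab z).1, hincr _ _ z (hlab z).2, hwork z⟩,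
        htime, Or.inl rfl, fun hs => absurd hs hnt, fun _ => rfl⟩⟩

lemma ae_transition_step {s : State ι} (hs : M.Consistent s) :
    ∀ᵐ s' ∂M.transition π s, M.Consistent s' ∧ M.Step s s' := by
  refine M.ae_transition π ?_ fun Δ hΔ => M.ae_jumpLaw_step π hs hΔ
  exact M.measurableSet_consistent.inter
    (M.measurableSet_step.preimage (f := fun s' => (s, s')) (by fun_prop))

lemma ae_isPath : ∀ᵐ S ∂M.law π, M.IsPath S := by
  have h : ∀ n, ∀ᵐ S ∂M.law π, M.Consistent (S n) →
      M.Consistent (S (n + 1)) ∧ M.Step (S n) (S (n + 1)) := by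
    intro n
    refine M.ae_law_pair π (P := fun p => M.Consistent p.1 → M.Consistent p.2 ∧ M.Step p.1 p.2)
      M.measurableSet_consistent_imp_step (Filter.Eventually.of_forall fun S => ?_)
    by_cases hs : M.Consistent (S n)
    · filter_upwards [M.ae_transition_step π hs] with s' hs' _ using hs'
    · exact Filter.Eventually.of_forall fun s' h => absurd h hs
  filter_upwards [M.ae_law_zero π, ae_all_iff.2 h] with S h0 hS
  have hc : ∀ n, M.Consistent (S n) := by
    intro n
    induction n with
    | zero => rw [h0]; exact M.consistent_initial
    | succ n ih => exact (hS n ih).1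
  exact ⟨h0, fun n => ⟨hc n, (hS n (hc n)).2⟩⟩

/-! ### Almost sure passage of the horizon -/

omit [DecidableEq ι] in
lemma rate_le {s : State ι} (hs : M.Consistent s) :
    M.rate s ≤ M.μ * (Fintype.card ι * M.U) + M.r := by
  have h : ∑ y, (s.work y : ℝ) ≤ Fintype.card ι * M.U := by
    refine (Finset.sum_le_card_nsmul Finset.univ _ (M.U : ℝ) fun y _ => ?_).trans_eq ?_
    · exact_mod_cast (hs.2.2 y).2.2.trans hs.2.1
    · simp
  have := mul_le_mul_of_nonneg_left h M.μ_pos.le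
  unfold rate
  linarith

/-- Reachable states have nonnegative time, so a wait longer than `T` passes the horizon. The rate
is bounded over reachable states by `rate_le`, which makes the probability of such a wait bounded
below. -/
lemma transition_time_lt_le {s : State ι} (hs : M.Consistent s) :
    M.transition π s {s' | s'.time < M.T} ≤ ENNReal.ofReal
      (1 - Real.exp (-((M.μ * (Fintype.card ι * M.U) + M.r) * max M.T 0))) := by
  have hA : MeasurableSet {s' : State ι | s'.time < M.T} :=
    measurableSet_lt (by fun_prop) measurable_const
  have hq := M.rate_pos s
  have hprob := isProbabilityMeasure_expMeasure hq
  rw [M.transition_apply π s hA]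
  calc ∫⁻ Δ, M.jumpLaw π (s, Δ) {s' | s'.time < M.T} ∂expMeasure (M.rate s)
      ≤ ∫⁻ Δ, (Set.Iic (max M.T 0)).indicator 1 Δ ∂expMeasure (M.rate s) := by
        refine lintegral_mono fun Δ => ?_
        by_cases hT : M.T ≤ s.time + Δ
        · rw [M.jumpLaw_of_le π (p := (s, Δ)) hT, Measure.dirac_apply' _ hA,
            Set.indicator_of_notMem (by simpa [cancelled, State.time] using hT)]
          exact zero_le
        · have hΔ : Δ ≤ M.T := by linarith [hs.1]
          rw [Set.indicator_of_mem (show Δ ∈ Set.Iic (max M.T 0) from le_max_of_le_left hΔ)]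
          exact (prob_le_one (μ := M.jumpKernel π (s, Δ)))
    _ = ENNReal.ofReal (cdf (expMeasure (M.rate s)) (max M.T 0)) := by
        rw [lintegral_indicator_one measurableSet_Iic, ofReal_cdf]
    _ ≤ _ := by
        refine ENNReal.ofReal_le_ofReal ?_
        -- `T` may be negative, whereas this form of the distribution function needs a nonnegative
        -- argument; hence `max T 0`.
        rw [cdf_expMeasure_eq hq, if_pos (le_max_right _ _)]
        have h1 : M.rate s * max M.T 0 ≤ (M.μ * (Fintype.card ι * M.U) + M.r) * max M.T 0 :=
          mul_le_mul_of_nonneg_right (M.rate_le hs) (le_max_right _ _)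
        linarith [Real.exp_le_exp.2 (neg_le_neg h1)]

/-- Time never decreases, so staying below the horizon for `n` steps means surviving `n` trials,
each with conditional probability at most `c`. -/
lemma law_time_lt_le (n : ℕ) : M.law π {S | (S n).time < M.T} ≤ ENNReal.ofReal
    (1 - Real.exp (-((M.μ * (Fintype.card ι * M.U) + M.r) * max M.T 0))) ^ n := by
  set c := ENNReal.ofReal
    (1 - Real.exp (-((M.μ * (Fintype.card ι * M.U) + M.r) * max M.T 0))) with hc
  have hA : MeasurableSet {s' : State ι | s'.time < M.T} :=
    measurableSet_lt (by fun_prop) measurable_const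
  have hev : ∀ n, Measurable fun S : ℕ → State ι => S n := fun n => by fun_prop
  induction n with
  | zero => simpa using prob_le_one
  | succ n ih =>
    have hAn : MeasurableSet {S : ℕ → State ι | (S n).time < M.T} := hA.preimage (hev n)
    have h2 : MeasurableSet {p : State ι × State ι | p.2.time < M.T} := hA.preimage (by fun_prop)
    have h1 : M.law π {S | (S (n + 1)).time < M.T} =
        ∫⁻ S, M.transition π (S n) {s' | s'.time < M.T} ∂M.law π := by
      have h3 : {S : ℕ → State ι | (S (n + 1)).time < M.T} =
          (fun S => (S n, S (n + 1))) ⁻¹' {p : State ι × State ι | p.2.time < M.T} := rfl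
      rw [h3, ← Measure.map_apply (by fun_prop) h2, law_map_pair, Measure.compProd_apply h2,
        lintegral_map (Kernel.measurable_kernel_prodMk_left h2) (hev n)]
      rfl
    calc M.law π {S | (S (n + 1)).time < M.T}
        = ∫⁻ S, M.transition π (S n) {s' | s'.time < M.T} ∂M.law π := h1
      _ ≤ ∫⁻ S, {S : ℕ → State ι | (S n).time < M.T}.indicator (fun _ => c) S ∂M.law π := by
          refine lintegral_mono_ae ?_
          filter_upwards [M.ae_isPath π] with S hS
          by_cases hT : (S n).time < M.T
          · rw [Set.indicator_of_mem (by exact hT)]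
            exact M.transition_time_lt_le π (hS.2 n).1
          · rw [Set.indicator_of_notMem (by exact hT), nonpos_iff_eq_zero]
            refine measure_mono_null ?_ (ae_iff.1 (M.ae_transition_step π (hS.2 n).1))
            intro s' hs' h
            exact absurd (h.2.1.trans_lt hs') hT
      _ = c * M.law π {S | (S n).time < M.T} := lintegral_indicator_const hAn c
      _ ≤ c ^ (n + 1) := by
          rw [pow_succ']
          gcongr

/-- The horizon elapses almost surely. -/
lemma ae_exists_le_time : ∀ᵐ S ∂M.law π, ∃ n, M.T ≤ (S n).time := by
  have hc : ENNReal.ofReal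
      (1 - Real.exp (-((M.μ * (Fintype.card ι * M.U) + M.r) * max M.T 0))) < 1 := by
    rw [ENNReal.ofReal_lt_one]
    linarith [Real.exp_pos (-((M.μ * (Fintype.card ι * M.U) + M.r) * max M.T 0))]
  rw [ae_iff, ← nonpos_iff_eq_zero]
  refine ge_of_tendsto' (ENNReal.tendsto_pow_atTop_nhds_zero_of_lt_one hc) fun n => ?_
  refine (measure_mono fun S hS => ?_).trans (M.law_time_lt_le π n)
  simp only [Set.mem_ofPred_eq, not_exists, not_le] at hS
  exact hS n

lemma ae_exists_terminal : ∀ᵐ S ∂M.law π, ∃ n, S n ∈ M.terminal := by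
  filter_upwards [M.ae_exists_le_time π] with S ⟨n, hn⟩ using ⟨n, Or.inl hn⟩

end Model

namespace Model

variable {ι : Type*} (M : Model ι) (x : ι) (lam : Fin M.U → ℝ)

/-! ### The value of a task decreases on average -/

/-- The price paid for the assignment to task `x` in the transition from `s` to `s'`. -/
noncomputable def stepCost (π : Policy ι) (s s' : State ι) : ℝ :=
  if s'.count = s.count + 1 then
    M.price lam s.count * ((π.1 (s, (s'.time - s.time).toNNReal) x : ℕ) : ℝ) else 0

/-- The policy that assigns a worker, to every task, if this is optimal for task `x`. -/
noncomputable def greedy : Policy ι :=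
  ⟨fun p _ => if M.taskValue x lam (p.1.count + 1) (p.1.work x) (M.positives x p.1)
      (M.negatives x p.1) (p.1.time + p.2) <
    M.taskValue x lam (p.1.count + 1) (p.1.work x + 1) (M.positives x p.1)
      (M.negatives x p.1) (p.1.time + p.2) - M.price lam p.1.count then 1 else 0, by
    refine measurable_pi_lambda _ fun _ => Measurable.ite ?_ measurable_const measurable_const
    have h1 : Measurable fun p : State ι × ℝ≥0 => M.price lam p.1.count :=
      (measurable_of_countable (M.price lam)).comp (f := fun p : State ι × ℝ≥0 => p.1.count)
        (by fun_prop)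
    refine measurableSet_lt ?_ (Measurable.sub ?_ h1)
    · exact M.measurable_taskValue x lam (by fun_prop) (by fun_prop) (by fun_prop) (by fun_prop)
        (by fun_prop)
    · exact M.measurable_taskValue x lam (by fun_prop) (by fun_prop) (by fun_prop) (by fun_prop)
        (by fun_prop)⟩

lemma abs_stepCost_le (π : Policy ι) (s s' : State ι) :
    |M.stepCost x lam π s s'| ≤ ∑ i, |lam i| := by
  have hL : 0 ≤ ∑ i, |lam i| := Finset.sum_nonneg fun i _ => abs_nonneg _
  unfold stepCost
  split_ifs
  · have h1 : ((π.1 (s, (s'.time - s.time).toNNReal) x : ℕ) : ℝ) ≤ 1 := by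
      exact_mod_cast Nat.lt_succ_iff.1 (Fin.is_lt _)
    rw [abs_mul, abs_of_nonneg (Nat.cast_nonneg _ : (0 : ℝ) ≤ _)]
    calc _ ≤ (∑ i, |lam i|) * 1 :=
          mul_le_mul (M.abs_price_le lam _) h1 (Nat.cast_nonneg _) hL
      _ = _ := mul_one _
  · simpa using hL

lemma measurable_stepCost (π : Policy ι) :
    Measurable fun p : State ι × State ι => M.stepCost x lam π p.1 p.2 := by
  have h1 : Measurable fun p : State ι × State ι => M.price lam p.1.count :=
    (measurable_of_countable (M.price lam)).comp (f := fun p : State ι × State ι => p.1.count)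
      (by fun_prop)
  have h2 : Measurable fun p : State ι × State ι =>
      π.1 (p.1, (p.2.time - p.1.time).toNNReal) x :=
    (measurable_pi_apply x).comp (π.2.comp (by fun_prop))
  have h3 : MeasurableSet {p : State ι × State ι | p.2.count = p.1.count + 1} :=
    measurableSet_eq_fun (by fun_prop) (by fun_prop)
  exact Measurable.ite h3
    (h1.mul ((measurable_of_countable fun i : Fin 2 => ((i : ℕ) : ℝ)).comp h2)) measurable_const

lemma abs_stateValue_le {s : State ι} (hs : M.Consistent s) :
    |M.stateValue x lam s| ≤ 1 + (3 * M.U : ℕ) * ∑ i, |lam i| :=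
  M.abs_taskValue_le x lam ((hs.2.2 x).2.2.trans hs.2.1) _ _ _

variable [Fintype ι] [DecidableEq ι] (π : Policy ι)

/-- The expectation of the value after one step, minus the price, given the time of the step. -/
lemma integral_jumpLaw_stateValue {s : State ι} (hs : M.Consistent s) {Δ : ℝ} (hΔ : 0 < Δ)
    {v G : ℝ}
    (hv : v = M.taskValue x lam s.count (s.work x) (M.positives x s) (M.negatives x s)
      (s.time + Δ))
    (hG : G = M.gain x lam (M.taskValue x lam) s.count (s.work x) (M.positives x s)
      (M.negatives x s) (s.time + Δ)) :
    (∫ s', (M.stateValue x lam s' - M.stepCost x lam π s s') ∂M.jumpLaw π (s, Δ) ≤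
      if M.T ≤ s.time + Δ then M.finalReward x (M.positives x s) (M.negatives x s)
      else v - (M.taskRate s.count (s.work x) * v - G) / M.rate s) ∧
    (π = M.greedy x lam →
      ∫ s', (M.stateValue x lam s' - M.stepCost x lam π s s') ∂M.jumpLaw π (s, Δ) =
        if M.T ≤ s.time + Δ then M.finalReward x (M.positives x s) (M.negatives x s)
        else v - (M.taskRate s.count (s.work x) * v - G) / M.rate s) := by
  have hq := M.rate_pos s
  have hr := M.r_pos
  obtain ⟨hα, hβ, -⟩ := hs.2.2 x
  rw [integral_jumpLaw]
  dsimp only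
  split_ifs with hT
  · have h1 : M.stateValue x lam (cancelled (s, Δ)) - M.stepCost x lam π s (cancelled (s, Δ)) =
        M.finalReward x (M.positives x s) (M.negatives x s) := by
      have h2 : M.stepCost x lam π s (cancelled (s, Δ)) = 0 :=
        if_neg (Nat.succ_ne_self s.count).symm
      rw [h2, sub_zero]
      exact M.taskValue_of_le x lam _ _ _ _ hT
    exact ⟨h1.le, fun _ => h1⟩
  -- `B` is the mean value after a completion at `x`.
  · set B := M.labelProb x (M.positives x s) (M.negatives x s) *
        M.taskValue x lam s.count (s.work x - 1) (M.positives x s + 1) (M.negatives x s)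
          (s.time + Δ) +
      (1 - M.labelProb x (M.positives x s) (M.negatives x s)) *
        M.taskValue x lam s.count (s.work x - 1) (M.positives x s) (M.negatives x s + 1)
          (s.time + Δ) with hB
    have hpos : ∀ y, M.stateValue x lam (positive y (s, Δ)) -
        M.stepCost x lam π s (positive y (s, Δ)) =
        if y = x then M.taskValue x lam s.count (s.work x - 1) (M.positives x s + 1)
          (M.negatives x s) (s.time + Δ) else v := by
      intro y
      have h2 : M.stepCost x lam π s (positive y (s, Δ)) = 0 :=
        if_neg (Nat.succ_ne_self s.count).symm
      rw [h2, sub_zero]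
      have h3 : M.negatives x (positive y (s, Δ)) = M.negatives x s := M.negatives_eq hβ
      unfold stateValue
      rw [h3]
      split_ifs with hy
      · subst hy
        have h4 : M.positives y (positive y (s, Δ)) = M.positives y s + 1 := by
          refine M.positives_eq ?_
          change s.alpha y + (Pi.single y (1 : ℝ) : ι → ℝ) y = _
          rw [hα]; simp [add_assoc]
        rw [h4]
        change M.taskValue y lam s.count (s.work y - (Pi.single y 1 : ι → ℕ) y) _ _ _ = _
        rw [Pi.single_eq_same]
        rfl
      · have h4 : M.positives x (positive y (s, Δ)) = M.positives x s := by
          refine M.positives_eq ?_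
          change s.alpha x + (Pi.single y (1 : ℝ) : ι → ℝ) x = _
          rw [Pi.single_eq_of_ne (Ne.symm hy), add_zero, hα]
        rw [h4, hv]
        change M.taskValue x lam s.count (s.work x - (Pi.single y 1 : ι → ℕ) x) _ _ _ = _
        rw [Pi.single_eq_of_ne (Ne.symm hy)]
        rfl
    have hneg : ∀ y, M.stateValue x lam (negative y (s, Δ)) -
        M.stepCost x lam π s (negative y (s, Δ)) =
        if y = x then M.taskValue x lam s.count (s.work x - 1) (M.positives x s)
          (M.negatives x s + 1) (s.time + Δ) else v := by
      intro y
      have h2 : M.stepCost x lam π s (negative y (s, Δ)) = 0 :=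
        if_neg (Nat.succ_ne_self s.count).symm
      rw [h2, sub_zero]
      have h3 : M.positives x (negative y (s, Δ)) = M.positives x s := M.positives_eq hα
      unfold stateValue
      rw [h3]
      split_ifs with hy
      · subst hy
        have h4 : M.negatives y (negative y (s, Δ)) = M.negatives y s + 1 := by
          refine M.negatives_eq ?_
          change s.beta y + (Pi.single y (1 : ℝ) : ι → ℝ) y = _
          rw [hβ]; simp [add_assoc]
        rw [h4]
        change M.taskValue y lam s.count (s.work y - (Pi.single y 1 : ι → ℕ) y) _ _ _ = _
        rw [Pi.single_eq_same]
        rfl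
      · have h4 : M.negatives x (negative y (s, Δ)) = M.negatives x s := by
          refine M.negatives_eq ?_
          change s.beta x + (Pi.single y (1 : ℝ) : ι → ℝ) x = _
          rw [Pi.single_eq_of_ne (Ne.symm hy), add_zero, hβ]
        rw [h4, hv]
        change M.taskValue x lam s.count (s.work x - (Pi.single y 1 : ι → ℕ) x) _ _ _ = _
        rw [Pi.single_eq_of_ne (Ne.symm hy)]
        rfl
    -- Completions at other tasks leave the value at `v`. The total completion rate is `rate - r`,
    -- so only the events at `x` contribute a deviation from `v`.
    have hsum : ∑ y, M.μ * s.work y / M.rate s *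
        (posProb (s.alpha y) (s.beta y) * (M.stateValue x lam (positive y (s, Δ)) -
            M.stepCost x lam π s (positive y (s, Δ))) +
          (1 - posProb (s.alpha y) (s.beta y)) * (M.stateValue x lam (negative y (s, Δ)) -
            M.stepCost x lam π s (negative y (s, Δ)))) =
        (M.rate s - M.r) / M.rate s * v + M.μ * s.work x / M.rate s * (B - v) := by
      have h1 : ∀ y, M.μ * s.work y / M.rate s *
          (posProb (s.alpha y) (s.beta y) * (M.stateValue x lam (positive y (s, Δ)) -
              M.stepCost x lam π s (positive y (s, Δ))) +
            (1 - posProb (s.alpha y) (s.beta y)) * (M.stateValue x lam (negative y (s, Δ)) -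
              M.stepCost x lam π s (negative y (s, Δ)))) =
          M.μ * s.work y / M.rate s * v +
            if y = x then M.μ * s.work x / M.rate s * (B - v) else 0 := by
        intro y
        rw [hpos, hneg]
        split_ifs with hy
        · subst hy
          rw [hB, labelProb, ← hα, ← hβ]
          ring
        · ring
      rw [Finset.sum_congr rfl fun y _ => h1 y, Finset.sum_add_distrib, ← Finset.sum_mul,
        ← Finset.sum_div, ← Finset.mul_sum, Finset.sum_ite_eq' Finset.univ x]
      simp [rate]
    rw [hsum]
    set A := M.stateValue x lam (M.arrival π (s, Δ)) -
      M.stepCost x lam π s (M.arrival π (s, Δ)) with hA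
    by_cases hℓ : s.count < M.U
    · set V0 := M.taskValue x lam (s.count + 1) (s.work x) (M.positives x s) (M.negatives x s)
        (s.time + Δ) with hV0
      set V1 := M.taskValue x lam (s.count + 1) (s.work x + 1) (M.positives x s)
        (M.negatives x s) (s.time + Δ) - M.price lam s.count with hV1
      have hG' : G = M.r * max V0 V1 + M.μ * s.work x * B := by
        rw [hG, gain, if_pos hℓ]
      have hrate : M.taskRate s.count (s.work x) = M.r + M.μ * s.work x := by
        rw [taskRate, if_pos hℓ]
      -- The deficit in the inequality is exactly the loss from a suboptimal decision at an arrival: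
      -- it is nonnegative, and zero for the greedy policy.
      have hdiff : v - (M.taskRate s.count (s.work x) * v - G) / M.rate s -
          (M.r / M.rate s * A + ((M.rate s - M.r) / M.rate s * v +
            M.μ * s.work x / M.rate s * (B - v))) = M.r / M.rate s * (max V0 V1 - A) := by
        rw [hG', hrate]
        field_simp
        ring
      have hAπ : A = if π.1 (s, Δ.toNNReal) x = 1 then V1 else V0 := by
        have hcount : (M.arrival π (s, Δ)) = (s.alpha, s.beta, s.time + Δ,
            fun y => s.work y + (π.1 (s, Δ.toNNReal) y : ℕ), s.count + 1) := if_pos hℓ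
        have hcost : M.stepCost x lam π s (M.arrival π (s, Δ)) =
            M.price lam s.count * ((π.1 (s, Δ.toNNReal) x : ℕ) : ℝ) := by
          rw [hcount, stepCost]
          change (if s.count + 1 = s.count + 1 then M.price lam s.count *
            ((π.1 (s, (s.time + Δ - s.time).toNNReal) x : ℕ) : ℝ) else 0) = _
          rw [if_pos rfl, add_sub_cancel_left]
        have hval : M.stateValue x lam (M.arrival π (s, Δ)) = M.taskValue x lam (s.count + 1)
            (s.work x + (π.1 (s, Δ.toNNReal) x : ℕ)) (M.positives x s) (M.negatives x s)
            (s.time + Δ) := by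
          rw [hcount]; rfl
        rw [hA, hcost, hval]
        generalize π.1 (s, Δ.toNNReal) x = i
        fin_cases i
        · simp [hV0]
        · simp [hV1]
      constructor
      · have h1 : A ≤ max V0 V1 := by
          rw [hAπ]
          split_ifs
          · exact le_max_right _ _
          · exact le_max_left _ _
        have h2 : 0 ≤ M.r / M.rate s * (max V0 V1 - A) :=
          mul_nonneg (by positivity) (sub_nonneg.2 h1)
        linarith
      · rintro rfl
        have h1 : A = max V0 V1 := by
          have h2 : (M.greedy x lam).1 (s, Δ.toNNReal) x = if V0 < V1 then 1 else 0 := by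
            rw [hV0, hV1]
            simp only [greedy, Real.coe_toNNReal Δ hΔ.le]
          rw [hAπ, h2]
          by_cases h3 : V0 < V1
          · simp [h3, max_eq_right h3.le]
          · simp [h3, max_eq_left (not_lt.1 h3)]
        rw [h1] at hdiff ⊢
        rw [sub_self, mul_zero] at hdiff
        linarith
    -- With the budget exhausted an arrival only advances time, so it joins the events that do not
    -- concern the task.
    · have hA' : A = v := by
        have hcount : (M.arrival π (s, Δ)) = (s.alpha, s.beta, s.time + Δ, s.work, s.count) :=
          if_neg hℓ
        have hcost : M.stepCost x lam π s (M.arrival π (s, Δ)) = 0 := by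
          rw [hcount]
          exact if_neg (Nat.succ_ne_self s.count).symm
        rw [hA, hcost, hcount, hv, sub_zero]
        rfl
      have hG' : G = M.μ * s.work x * B := by
        rw [hG, gain, if_neg hℓ, zero_add]
      have hrate : M.taskRate s.count (s.work x) = M.μ * s.work x := by
        rw [taskRate, if_neg hℓ, zero_add]
      have heq : M.r / M.rate s * A + ((M.rate s - M.r) / M.rate s * v +
            M.μ * s.work x / M.rate s * (B - v)) =
          v - (M.taskRate s.count (s.work x) * v - G) / M.rate s := by
        rw [hA', hG', hrate]
        field_simp
        ring
      exact ⟨heq.le, fun _ => heq⟩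

lemma integrable_step {s : State ι} (hs : M.Consistent s) :
    Integrable (fun s' => M.stateValue x lam s' - M.stepCost x lam π s s')
      (M.transition π s) := by
  have hm : Measurable fun s' => M.stateValue x lam s' - M.stepCost x lam π s s' :=
    (M.measurable_stateValue x lam).sub
      ((M.measurable_stepCost x lam π).comp (f := fun s' => (s, s')) (by fun_prop))
  refine Integrable.of_bound hm.aestronglyMeasurable
    (1 + (3 * M.U : ℕ) * ∑ i, |lam i| + ∑ i, |lam i|) ?_
  filter_upwards [M.ae_transition_step π hs] with s' hs'
  exact (abs_sub _ _).trans (add_le_add (M.abs_stateValue_le x lam hs'.1)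
    (M.abs_stepCost_le x lam π s s'))

/-- The value of the task is a supersolution of the optimality equation of the full system, and
the greedy policy attains equality. -/
lemma integral_transition_stateValue {s : State ι} (hs : M.Consistent s) :
    (∫ s', (M.stateValue x lam s' - M.stepCost x lam π s s') ∂M.transition π s ≤
      M.stateValue x lam s) ∧
    (π = M.greedy x lam →
      ∫ s', (M.stateValue x lam s' - M.stepCost x lam π s s') ∂M.transition π s =
        M.stateValue x lam s) := by
  have hq := M.rate_pos s
  have hprob := isProbabilityMeasure_expMeasure hq
  set φ : ℝ → ℝ := fun Δ => M.taskValue x lam s.count (s.work x) (M.positives x s)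
    (M.negatives x s) (s.time + Δ) with hφ
  set γ : ℝ → ℝ := fun Δ => M.gain x lam (M.taskValue x lam) s.count (s.work x)
    (M.positives x s) (M.negatives x s) (s.time + Δ) with hγ
  set φ' : ℝ → ℝ := fun Δ => M.taskRate s.count (s.work x) * φ Δ - γ Δ with hφ'
  set a := max (M.T - s.time) 0 with ha
  have hφc : Continuous φ := (M.continuous_taskValue x lam _ _ _ _).comp (by fun_prop)
  have hγc : Continuous γ :=
    (M.continuous_gain x lam (M.continuous_taskValue x lam) _ _ _ _).comp (by fun_prop)
  have hφ'c : Continuous φ' := by fun_prop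
  have hφa : φ a = M.finalReward x (M.positives x s) (M.negatives x s) :=
    M.taskValue_of_le x lam _ _ _ _ (by linarith [le_max_left (M.T - s.time) 0])
  -- The backward equation holds with the rate of the task, but the clock runs at the total rate.
  -- `integral_expMeasure_eq` allows this, as it holds for any positive rate.
  have hmain : ∫ Δ, (if a ≤ Δ then φ a else φ Δ - φ' Δ / M.rate s) ∂expMeasure (M.rate s) =
      M.stateValue x lam s := by
    rw [integral_expMeasure_eq hq (le_max_right _ _) hφc.continuousOn hφ'c.continuousOn]
    · simp only [hφ, add_zero]
      rfl
    · intro Δ hΔ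
      have hlt : s.time + Δ < M.T := by
        rcases lt_max_iff.1 hΔ.2 with h | h
        · linarith
        · linarith [hΔ.1]
      exact (M.hasDerivAt_taskValue x lam s.count (s.work x) _ _ hlt).comp_const_add s.time Δ
  have hcond : ∀ Δ : ℝ, 0 < Δ → (a ≤ Δ ↔ M.T ≤ s.time + Δ) := by
    intro Δ hΔ
    rw [ha, max_le_iff, sub_le_iff_le_add']
    exact ⟨fun h => h.1, fun h => ⟨h, hΔ.le⟩⟩
  have hint := M.integrable_step x lam π hs
  rw [M.integral_transition π s hint, ← hmain]
  constructor
  · refine integral_mono_ae (M.integrable_integral_jumpLaw π s hint) ?_ ?_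
    -- The comparison function must be integrable: it is continuous up to `a` and constant
    -- afterwards.
    · obtain ⟨C, hC⟩ := isCompact_Icc.exists_bound_of_continuousOn (s := Set.Icc 0 a)
        (f := fun Δ => φ Δ - φ' Δ / M.rate s) (by fun_prop)
      refine Integrable.of_bound (C := max C |φ a|) (Measurable.aestronglyMeasurable
        (Measurable.ite measurableSet_Ici measurable_const (by fun_prop))) ?_
      filter_upwards [ae_expMeasure_pos (M.rate s)] with Δ hΔ
      split_ifs with h
      · exact le_max_right _ _
      · exact le_max_of_le_left (hC Δ ⟨hΔ.le, (not_le.1 h).le⟩)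
    · filter_upwards [ae_expMeasure_pos (M.rate s)] with Δ hΔ
      have h := (M.integral_jumpLaw_stateValue x lam π hs hΔ (v := φ Δ) (G := γ Δ) rfl rfl).1
      rw [← hφa] at h
      simpa only [hcond Δ hΔ] using h
  · intro hπ
    refine integral_congr_ae ?_
    filter_upwards [ae_expMeasure_pos (M.rate s)] with Δ hΔ
    have h := (M.integral_jumpLaw_stateValue x lam π hs hΔ (v := φ Δ) (G := γ Δ) rfl rfl).2 hπ
    rw [← hφa] at h
    simpa only [hcond Δ hΔ] using h

end Model

namespace Model

open Filter

variable {ι : Type*} {M : Model ι} {S : ℕ → State ι}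

/-! ### Rewards and prices along a trajectory -/

namespace IsPath

lemma monotone_time (h : M.IsPath S) : Monotone fun n => (S n).time :=
  monotone_nat_of_le_succ fun n => (h.2 n).2.1

lemma monotone_count (h : M.IsPath S) : Monotone fun n => (S n).count :=
  monotone_nat_of_le_succ fun n => by
    rcases (h.2 n).2.2.1 with h1 | h1 <;> omega

lemma count_zero (h : M.IsPath S) : (S 0).count = 0 := by
  rw [h.1]; rfl

lemma count_eq (h : M.IsPath S) {m n : ℕ} (hm : M.T ≤ (S m).time) (hmn : m ≤ n) :
    (S n).count = (S m).count := by
  induction n, hmn using Nat.le_induction with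
  | base => rfl
  | succ n hn ih => rw [(h.2 n).2.2.2.2 (hm.trans (h.monotone_time hn)), ih]

lemma terminal_of_le (h : M.IsPath S) {m n : ℕ} (hm : S m ∈ M.terminal) (hmn : m ≤ n) :
    S n ∈ M.terminal ∧ (S n).alpha = (S m).alpha ∧ (S n).beta = (S m).beta := by
  induction n, hmn using Nat.le_induction with
  | base => exact ⟨hm, rfl, rfl⟩
  | succ n hn ih =>
    obtain ⟨h1, h2, h3⟩ := (h.2 n).2.2.2.1 ih.1
    exact ⟨h1, h2.trans ih.2.1, h3.trans ih.2.2⟩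

/-- Counts are monotone along a path, so the step that raises the count is the first visit to the
new value. -/
lemma arrivalIndex_eq (h : M.IsPath S) {n : ℕ} (hn : (S (n + 1)).count = (S n).count + 1) :
    arrivalIndex S ((S n).count + 1) = n + 1 := by
  refine IsLeast.csInf_eq ⟨hn, fun m hm => ?_⟩
  by_contra! hlt
  have h1 : (S m).count ≤ (S n).count := h.monotone_count (Nat.lt_succ_iff.1 hlt)
  have h2 : (S m).count = (S n).count + 1 := hm
  omega

lemma assigned_eq (h : M.IsPath S) {n : ℕ} (hn : (S (n + 1)).count = (S n).count + 1)
    (π : Policy ι) (x : ι) : assigned π S ((S n).count + 1) x =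
      ((π.1 (S n, ((S (n + 1)).time - (S n).time).toNNReal) x : ℕ) : ℝ) := by
  rw [assigned, if_pos ⟨n + 1, hn⟩, h.arrivalIndex_eq hn]
  rfl

/-- The count rises by at most one per event, so a sum over events can be reindexed by workers.
Index `i` stands for worker `i + 1`. -/
lemma sum_stepCost (h : M.IsPath S) (π : Policy ι) (x : ι) (lam : Fin M.U → ℝ) (N : ℕ) :
    ∑ n ∈ Finset.range N, M.stepCost x lam π (S n) (S (n + 1)) =
      ∑ i : Fin M.U, if (i : ℕ) < (S N).count then lam i * assigned π S (i + 1) x else 0 := by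
  induction N with
  | zero => simp [h.count_zero]
  | succ N ih =>
    rw [Finset.sum_range_succ, ih]
    rcases (h.2 N).2.2.1 with h1 | ⟨h1, hU⟩
    · rw [stepCost, if_neg (by omega), add_zero, h1]
    · rw [stepCost, if_pos h1, ← h.assigned_eq h1, price, dif_pos hU, h1]
      have h2 : ∀ i : Fin M.U,
          (if (i : ℕ) < (S N).count + 1 then lam i * assigned π S (i + 1) x else 0) =
          (if (i : ℕ) < (S N).count then lam i * assigned π S (i + 1) x else 0) +
            if i = ⟨(S N).count, hU⟩ then
              lam ⟨(S N).count, hU⟩ * assigned π S ((S N).count + 1) x else 0 := by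
        intro i
        by_cases hi : i = ⟨(S N).count, hU⟩
        · subst hi; simp
        · have hi' : (i : ℕ) ≠ (S N).count := fun h => hi (Fin.ext h)
          have h3 : (i : ℕ) < (S N).count + 1 ↔ (i : ℕ) < (S N).count := by omega
          simp only [h3, if_neg hi, add_zero]
      rw [Finset.sum_congr rfl fun i _ => h2 i, Finset.sum_add_distrib, Finset.sum_ite_eq']
      simp

lemma sum_stepCost_eq (h : M.IsPath S) (π : Policy ι) (x : ι) (lam : Fin M.U → ℝ) {N : ℕ}
    (hN : M.T ≤ (S N).time) :
    ∑ n ∈ Finset.range N, M.stepCost x lam π (S n) (S (n + 1)) =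
      ∑ i : Fin M.U, lam i * assigned π S (i + 1) x := by
  rw [h.sum_stepCost]
  refine Finset.sum_congr rfl fun i _ => ?_
  split_ifs with hi
  · rfl
  -- After the horizon the count is frozen, so this worker never enters and the default value `0` of
  -- `assigned` applies.
  · rw [assigned, if_neg, mul_zero]
    rintro ⟨n, hn⟩
    have h1 : (S n).count ≤ (S N).count := by
      rcases le_total n N with hnN | hnN
      · exact h.monotone_count hnN
      · exact (h.count_eq hN hnN).le
    omega

/-- The posterior is frozen from `endTime` on, so the reward can be read at any index past the
horizon, where the value equals the final reward. -/
lemma taskReward_eq (h : M.IsPath S) (x : ι) (lam : Fin M.U → ℝ) {N : ℕ}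
    (hN : M.T ≤ (S N).time) : M.taskReward x S = M.stateValue x lam (S N) := by
  have hterm : S N ∈ M.terminal := Or.inl hN
  have h1 : S (M.endTime S) ∈ M.terminal := Nat.sInf_mem (s := {n | S n ∈ M.terminal}) ⟨N, hterm⟩
  have h2 : M.endTime S ≤ N := Nat.sInf_le (m := N) (s := {n | S n ∈ M.terminal}) hterm
  obtain ⟨-, h3, h4⟩ := h.terminal_of_le h1 h2
  obtain ⟨h5, h6, -⟩ := (h.2 N).1.2.2 x
  rw [taskReward, ← h3, ← h4, stateValue, M.taskValue_of_le x lam _ _ _ _ hN, finalReward,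
    ← h5, ← h6]

end IsPath

lemma assigned_mem_Icc (π : Policy ι) (S : ℕ → State ι) (ℓ : ℕ) (x : ι) :
    assigned π S ℓ x ∈ Set.Icc (0 : ℝ) 1 := by
  unfold assigned
  split_ifs
  · exact ⟨Nat.cast_nonneg _, by exact_mod_cast Nat.lt_succ_iff.1 (Fin.is_lt _)⟩
  · exact ⟨le_rfl, zero_le_one⟩

/-- Each worker is charged at most once, so the bound does not depend on `N`; dominated convergence
relies on this. -/
lemma IsPath.abs_sum_stepCost_le (h : M.IsPath S) (π : Policy ι) (x : ι) (lam : Fin M.U → ℝ)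
    (N : ℕ) : |∑ n ∈ Finset.range N, M.stepCost x lam π (S n) (S (n + 1))| ≤ ∑ i, |lam i| := by
  rw [h.sum_stepCost]
  refine (Finset.abs_sum_le_sum_abs _ _).trans (Finset.sum_le_sum fun i _ => ?_)
  split_ifs
  · obtain ⟨h0, h1⟩ := assigned_mem_Icc π S (i + 1) x
    rw [abs_mul, abs_of_nonneg h0]
    exact mul_le_of_le_one_right (abs_nonneg _) h1
  · simp

variable (M) in
/-- The reward from task `x` minus the prices of the workers assigned to it. -/
noncomputable def penalized (x : ι) (lam : Fin M.U → ℝ) (π : Policy ι) (S : ℕ → State ι) : ℝ :=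
  M.taskReward x S - ∑ i : Fin M.U, lam i * assigned π S (i + 1) x

/-- The value of task `x` after `N` events, minus the prices paid so far. -/
noncomputable def netValue (M : Model ι) (x : ι) (lam : Fin M.U → ℝ) (π : Policy ι) (N : ℕ)
    (S : ℕ → State ι) : ℝ :=
  M.stateValue x lam (S N) - ∑ n ∈ Finset.range N, M.stepCost x lam π (S n) (S (n + 1))

lemma IsPath.netValue_eq (h : M.IsPath S) (π : Policy ι) (x : ι) (lam : Fin M.U → ℝ) {N : ℕ}
    (hN : M.T ≤ (S N).time) : M.netValue x lam π N S = M.penalized x lam π S := by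
  rw [netValue, h.sum_stepCost_eq π x lam hN, ← h.taskReward_eq x lam hN, penalized]

lemma IsPath.abs_netValue_le (h : M.IsPath S) (π : Policy ι) (x : ι) (lam : Fin M.U → ℝ)
    (N : ℕ) : |M.netValue x lam π N S| ≤
      1 + (3 * M.U : ℕ) * ∑ i, |lam i| + ∑ i, |lam i| :=
  (abs_sub _ _).trans (add_le_add (M.abs_stateValue_le x lam (h.2 N).1)
    (h.abs_sum_stepCost_le π x lam N))

lemma IsPath.taskReward_mem_Icc (h : M.IsPath S) (x : ι) :
    M.taskReward x S ∈ Set.Icc (0 : ℝ) 1 := by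
  obtain ⟨h5, h6, -⟩ := (h.2 (M.endTime S)).1.2.2 x
  rw [taskReward, h5, h6]
  exact M.finalReward_mem_Icc x _ _

/-! ### Expected net value and its limit -/

variable [Fintype ι] [DecidableEq ι]

variable (M) (π : Policy ι) (x : ι) (lam : Fin M.U → ℝ)

omit [Fintype ι] [DecidableEq ι] in
lemma measurable_netValue (N : ℕ) : Measurable (M.netValue x lam π N) := by
  refine Measurable.sub ?_ (Finset.measurable_sum _ fun n _ => ?_)
  · exact (M.measurable_stateValue x lam).comp (measurable_pi_apply N)
  · exact (M.measurable_stepCost x lam π).comp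
      (f := fun S : ℕ → State ι => (S n, S (n + 1))) (by fun_prop)

lemma integrable_netValue (N : ℕ) : Integrable (M.netValue x lam π N) (M.law π) := by
  refine Integrable.of_bound (M.measurable_netValue π x lam N).aestronglyMeasurable
    (1 + (3 * M.U : ℕ) * ∑ i, |lam i| + ∑ i, |lam i|) ?_
  filter_upwards [M.ae_isPath π] with S hS using hS.abs_netValue_le π x lam N

/-- The increment is a function of two consecutive states, so `integral_law_pair` reduces the claim
to the one-step estimate, with no need for a filtration. -/
lemma integral_netValue_succ (N : ℕ) :
    (∫ S, M.netValue x lam π (N + 1) S ∂M.law π ≤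
      ∫ S, M.netValue x lam π N S ∂M.law π) ∧
    (π = M.greedy x lam → ∫ S, M.netValue x lam π (N + 1) S ∂M.law π =
      ∫ S, M.netValue x lam π N S ∂M.law π) := by
  set g : State ι × State ι → ℝ := fun p =>
    M.stateValue x lam p.2 - M.stepCost x lam π p.1 p.2 - M.stateValue x lam p.1 with hg
  have hgm : Measurable g :=
    (((M.measurable_stateValue x lam).comp measurable_snd).sub
      (M.measurable_stepCost x lam π)).sub ((M.measurable_stateValue x lam).comp measurable_fst)
  have hdiff : ∀ S, g (S N, S (N + 1)) =
      M.netValue x lam π (N + 1) S - M.netValue x lam π N S := by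
    intro S
    rw [netValue, netValue, Finset.sum_range_succ]
    ring
  have hi1 := M.integrable_netValue π x lam (N + 1)
  have hi0 := M.integrable_netValue π x lam N
  have hgi : Integrable (fun S => g (S N, S (N + 1))) (M.law π) :=
    (hi1.sub hi0).congr (Eventually.of_forall fun S => (hdiff S).symm)
  have hkey := M.integral_law_pair π hgm hgi
  rw [integral_congr_ae (Eventually.of_forall hdiff), integral_sub hi1 hi0] at hkey
  have hinner : ∀ᵐ S ∂M.law π, ∫ s', g (S N, s') ∂M.transition π (S N) =
      ∫ s', (M.stateValue x lam s' - M.stepCost x lam π (S N) s') ∂M.transition π (S N) -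
        M.stateValue x lam (S N) := by
    filter_upwards [M.ae_isPath π] with S hS
    simp only [hg]
    rw [integral_sub (M.integrable_step x lam π (hS.2 N).1) (integrable_const _)]
    simp
  constructor
  · rw [← sub_nonpos, hkey]
    refine integral_nonpos_of_ae ?_
    filter_upwards [hinner, M.ae_isPath π] with S h1 hS
    rw [h1]
    exact sub_nonpos.2 (M.integral_transition_stateValue x lam π (hS.2 N).1).1
  · intro hπ
    rw [← sub_eq_zero, hkey]
    refine integral_eq_zero_of_ae ?_
    filter_upwards [hinner, M.ae_isPath π] with S h1 hS
    rw [h1]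
    exact sub_eq_zero.2 ((M.integral_transition_stateValue x lam π (hS.2 N).1).2 hπ)

lemma integral_netValue_zero :
    ∫ S, M.netValue x lam π 0 S ∂M.law π = M.stateValue x lam M.initial := by
  have h : M.netValue x lam π 0 =ᵐ[M.law π] fun _ => M.stateValue x lam M.initial := by
    filter_upwards [M.ae_law_zero π] with S hS
    simp [netValue, hS]
  rw [integral_congr_ae h]
  simp

lemma ae_tendsto_netValue : ∀ᵐ S ∂M.law π,
    Tendsto (fun N => M.netValue x lam π N S) atTop (nhds (M.penalized x lam π S)) := by
  filter_upwards [M.ae_isPath π, M.ae_exists_le_time π] with S hS ⟨n, hn⟩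
  refine tendsto_const_nhds.congr' ?_
  filter_upwards [eventually_ge_atTop n] with N hN
  exact (hS.netValue_eq π x lam (hn.trans (hS.monotone_time hN))).symm

/-- Being an almost sure limit of measurable functions, the penalized reward needs no separate
measurability argument for `endTime`, `arrivalIndex` or `labelReward`. -/
lemma aestronglyMeasurable_penalized :
    AEStronglyMeasurable (M.penalized x lam π) (M.law π) :=
  aestronglyMeasurable_of_tendsto_ae atTop
    (fun N => (M.measurable_netValue π x lam N).aestronglyMeasurable)
    (M.ae_tendsto_netValue π x lam)

lemma ae_abs_penalized_le : ∀ᵐ S ∂M.law π, |M.penalized x lam π S| ≤ 1 + ∑ i, |lam i| := by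
  filter_upwards [M.ae_isPath π, M.ae_exists_le_time π] with S hS ⟨n, hn⟩
  rw [penalized, ← hS.sum_stepCost_eq π x lam hn]
  obtain ⟨h0, h1⟩ := hS.taskReward_mem_Icc x
  refine (abs_sub _ _).trans (add_le_add ?_ (hS.abs_sum_stepCost_le π x lam n))
  rwa [abs_of_nonneg h0]

lemma integrable_penalized : Integrable (M.penalized x lam π) (M.law π) :=
  Integrable.of_bound (M.aestronglyMeasurable_penalized π x lam) _
    (M.ae_abs_penalized_le π x lam)

lemma integral_penalized_le_bound :
    ∫ S, M.penalized x lam π S ∂M.law π ≤ 1 + ∑ i, |lam i| := by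
  have h : ∫ _, (1 + ∑ i, |lam i|) ∂M.law π = 1 + ∑ i, |lam i| := by simp
  rw [← h]
  refine integral_mono_ae (M.integrable_penalized π x lam) (integrable_const _) ?_
  filter_upwards [M.ae_abs_penalized_le π x lam] with S hS using (le_abs_self _).trans hS

lemma tendsto_integral_netValue :
    Tendsto (fun N => ∫ S, M.netValue x lam π N S ∂M.law π) atTop
      (nhds (∫ S, M.penalized x lam π S ∂M.law π)) := by
  refine tendsto_integral_of_dominated_convergence
    (fun _ => 1 + (3 * M.U : ℕ) * ∑ i, |lam i| + ∑ i, |lam i|)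
    (fun N => (M.measurable_netValue π x lam N).aestronglyMeasurable) (integrable_const _)
    (fun N => ?_) (M.ae_tendsto_netValue π x lam)
  filter_upwards [M.ae_isPath π] with S hS using hS.abs_netValue_le π x lam N

/-- Verification: no policy of the full system earns more from task `x` than its optimal value. -/
theorem integral_penalized_le :
    ∫ S, M.penalized x lam π S ∂M.law π ≤ M.stateValue x lam M.initial := by
  refine le_of_tendsto' (M.tendsto_integral_netValue π x lam) fun N => ?_
  rw [← M.integral_netValue_zero π x lam]
  exact antitone_nat_of_succ_le (f := fun N => ∫ S, M.netValue x lam π N S ∂M.law π)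
    (fun n => (M.integral_netValue_succ π x lam n).1) (Nat.zero_le N)

/-- The greedy policy earns the optimal value from task `x`. -/
theorem integral_penalized_greedy :
    ∫ S, M.penalized x lam (M.greedy x lam) S ∂M.law (M.greedy x lam) =
      M.stateValue x lam M.initial := by
  refine tendsto_nhds_unique (M.tendsto_integral_netValue (M.greedy x lam) x lam) ?_
  refine tendsto_const_nhds.congr fun N => ?_
  induction N with
  | zero => exact (M.integral_netValue_zero _ x lam).symm
  | succ N ih => rw [ih, (M.integral_netValue_succ _ x lam N).2 rfl]

/-! ### The decomposed bound -/

lemma bddAbove_penalizedReward (M : Model Unit) (lam : Fin M.U → ℝ) :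
    BddAbove (Set.range fun π : Policy Unit => ∫ S, M.penalizedReward lam π S ∂M.law π) :=
  ⟨1 + ∑ i, |lam i|, by
    rintro _ ⟨π, rfl⟩
    exact M.integral_penalized_le_bound π () lam⟩

-- The recursion uses only the common rates, horizon and budget and the data of task `x`, all of
-- which `single` retains.
omit [Fintype ι] [DecidableEq ι] in
lemma iterValue_single (m : ℕ) :
    (M.single x).iterValue () lam m = M.iterValue x lam m := by
  induction m with
  | zero => rfl
  | succ m ih =>
    funext ℓ w k j
    rw [iterValue_succ, iterValue_succ, ih]
    rfl

omit [Fintype ι] [DecidableEq ι] in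
lemma stateValue_single :
    (M.single x).stateValue () lam (M.single x).initial = M.stateValue x lam M.initial := by
  unfold stateValue taskValue
  rw [iterValue_single]
  rfl

/-- The optimal value of the single-task problem dominates the penalized reward from the task
under every policy of the full system. -/
theorem integral_penalized_le_penalizedValue :
    ∫ S, M.penalized x lam π S ∂M.law π ≤ (M.single x).penalizedValue lam := by
  refine (M.integral_penalized_le π x lam).trans ?_
  rw [← M.stateValue_single x lam, ← (M.single x).integral_penalized_greedy () lam]
  exact le_ciSup ((M.single x).bddAbove_penalizedReward lam) ((M.single x).greedy () lam)

/-- At zero prices the penalized reward is the reward itself. -/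
lemma integrable_taskReward : Integrable (M.taskReward x) (M.law π) := by
  refine (M.integrable_penalized π x 0).congr (Eventually.of_forall fun S => ?_)
  simp [penalized]

lemma integrable_reward : Integrable M.reward (M.law π) :=
  integrable_finsetSum _ fun x _ => M.integrable_taskReward π x

-- The sole use of feasibility: all assignments of one worker are read at the same state and delay.
omit [DecidableEq ι] in
lemma sum_assigned_le_one {π : Policy ι} (hπ : π ∈ feasiblePolicies ι) (S : ℕ → State ι) (ℓ : ℕ) :
    ∑ x, assigned π S ℓ x ≤ 1 := by
  unfold assigned
  split_ifs
  · exact_mod_cast hπ _ _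
  · simp

theorem integral_reward_le_bound {π : Policy ι} (hπ : π ∈ feasiblePolicies ι)
    {lam : Fin M.U → ℝ} (hlam : 0 ≤ lam) :
    ∫ S, M.reward S ∂M.law π ≤ M.bound lam := by
  have hsum : Integrable (fun S => ∑ x, M.penalized x lam π S) (M.law π) :=
    integrable_finsetSum _ fun x _ => M.integrable_penalized π x lam
  calc ∫ S, M.reward S ∂M.law π
      ≤ ∫ S, (∑ x, M.penalized x lam π S + ∑ i, lam i) ∂M.law π := by
        refine integral_mono (M.integrable_reward π) (hsum.add (integrable_const _)) fun S => ?_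
        -- Weak duality: nonnegative prices turn the constraint on each worker into a bound on the
        -- total charge.
        have h1 : ∑ x, ∑ i : Fin M.U, lam i * assigned π S (i + 1) x ≤ ∑ i, lam i := by
          rw [Finset.sum_comm]
          refine Finset.sum_le_sum fun i _ => ?_
          rw [← Finset.mul_sum]
          exact mul_le_of_le_one_right (hlam i) (sum_assigned_le_one hπ S _)
        simp only [reward, penalized, Finset.sum_sub_distrib]
        linarith
    _ = ∑ x, ∫ S, M.penalized x lam π S ∂M.law π + ∑ i, lam i := by
        rw [integral_add hsum (integrable_const _),
          integral_finsetSum _ fun x _ => M.integrable_penalized π x lam]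
        simp
    _ ≤ M.bound lam := by
        unfold bound
        gcongr with x
        exact M.integral_penalized_le_penalizedValue π x lam

instance : Nonempty (feasiblePolicies ι) :=
  ⟨⟨⟨fun _ _ => 0, measurable_const⟩, fun _ _ => by simp⟩⟩

theorem optimalValue_le_bound {lam : Fin M.U → ℝ} (hlam : 0 ≤ lam) :
    M.optimalValue ≤ M.bound lam :=
  ciSup_le fun π => M.integral_reward_le_bound π.2 hlam

end Model

end Crowdsourcing

/-- Every chain terminates almost surely and all expectations, suprema and the infimum are of
integrable functions and bounded sets; the decomposed Lagrangian bound holds for each `lam ≥ 0`,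
and for the infimum. -/
theorem theorem2 {K : ℕ} (M : Crowdsourcing.Model (Fin K)) :
    (∀ π : Crowdsourcing.Policy (Fin K),
      (∀ᵐ S ∂(M.law π), ∃ n, S n ∈ M.terminal) ∧ MeasureTheory.Integrable M.reward (M.law π)) ∧
    BddAbove (Set.range fun π : Crowdsourcing.feasiblePolicies (Fin K) =>
      ∫ S, M.reward S ∂(M.law π.1)) ∧
    (∀ (x : Fin K) (π : Crowdsourcing.Policy Unit),
      (∀ᵐ S ∂((M.single x).law π), ∃ n, S n ∈ (M.single x).terminal) ∧
      ∀ lam : Fin M.U → ℝ,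
        MeasureTheory.Integrable ((M.single x).penalizedReward lam π) ((M.single x).law π)) ∧
    (∀ (x : Fin K) (lam : Fin M.U → ℝ),
      BddAbove (Set.range fun π : Crowdsourcing.Policy Unit =>
        ∫ S, (M.single x).penalizedReward lam π S ∂((M.single x).law π))) ∧
    BddBelow (Set.range fun lam : {lam : Fin M.U → ℝ // 0 ≤ lam} => M.bound lam.1) ∧
    (∀ lam : Fin M.U → ℝ, 0 ≤ lam → M.optimalValue ≤ M.bound lam) ∧
    M.optimalValue ≤ ⨅ lam : {lam : Fin M.U → ℝ // 0 ≤ lam}, M.bound lam.1 := by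
  have hle : ∀ lam : Fin M.U → ℝ, 0 ≤ lam → M.optimalValue ≤ M.bound lam :=
    fun _ hlam => M.optimalValue_le_bound hlam
  have : Nonempty {lam : Fin M.U → ℝ // 0 ≤ lam} := ⟨⟨0, le_rfl⟩⟩
  refine ⟨fun π => ⟨M.ae_exists_terminal π, M.integrable_reward π⟩, ?_,
    fun x π => ⟨(M.single x).ae_exists_terminal π,
      fun lam => (M.single x).integrable_penalized π () lam⟩,
    fun x lam => (M.single x).bddAbove_penalizedReward lam, ?_, hle, ?_⟩
  -- Any admissible price vector gives an upper bound; zero is the simplest.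
  · refine ⟨M.bound 0, ?_⟩
    rintro _ ⟨π, rfl⟩
    exact M.integral_reward_le_bound π.2 le_rfl
  · refine ⟨M.optimalValue, ?_⟩
    rintro _ ⟨lam, rfl⟩
    exact hle lam.1 lam.2
  · exact le_ciInf fun lam => hle lam.1 lam.2
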